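/- **Proposition 1.1.** Let $n\ge 1$, let $M$ be a compact connected smooth $n$-dimensional manifold without boundary, let $X:M\to\mathbb{R}^{n+1}$ be a smooth immersion and let $N$ assign to each $p\in M$ a unit vector $N(p)\in\mathbb R^{n+1}$ normal to $X$ at $p$. Let $h(v,w)=\langle D^2X(v,w),N\rangle$ be the second fundamental form, and let $H=\sum_{i,j} g^{ij}h_{ij}$ be the mean curvature, i.e. the trace of $h$ with respect to the induced metric $g$ (so that the sphere of radius $r$ with its inner normal has $H=n/r$). Suppose that $X$ is a $\lambda$-hypersurface, that is, for some constant $\lambda\in\mathbb{R}$, $$\langle X,N\rangle+H=\lambda\quad\text{on } M.$$ If $$\Bigl(H-\frac{\lambda}{2}\Bigr)^2\le n+\frac{\lambda^2}{4}\quad\text{on } M,$$ then $\bigl(H-\frac{\lambda}{2}\bigr)^2= n+\frac{\lambda^2}{4}$ at every point of $M$, and $M$ with the induced metric is isometric to the round sphere $S^n(r)\subset\mathbb{R}^{n+1}$ for some radius $r>0$. -/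

import Mathlib

open scoped Manifold ContDiff

noncomputable section

namespace LambdaHypersurface

/-- The first fundamental form (induced metric) of a map `X` from an `n`-manifold into a Euclidean
space: the bilinear form `g_p(v, w) = ⟨dX_p v, dX_p w⟩` on the tangent space at `p`. -/
def firstFundamentalForm {n m : ℕ} {M : Type*} [TopologicalSpace M]
    [ChartedSpace (EuclideanSpace ℝ (Fin n)) M]
    (X : M → EuclideanSpace ℝ (Fin m)) (p : M) (v w : TangentSpace (𝓡 n) p) : ℝ :=
  inner ℝ (mvfderiv (𝓡 n) X p v) (mvfderiv (𝓡 n) X p w)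

/-- The second fundamental form of `X` at `p` with respect to the normal vector `ν`:
`h_p(v, w) = ⟨D²F(v, w), ν⟩`, where `F = X ∘ φ⁻¹` is the local parametrization given by the
preferred chart `φ` at `p`. (Mathlib identifies the tangent space at `p` with the model space
through this very chart. When `ν` is normal at `p`, the form does not depend on the chart; with
this sign, the unit sphere with its inner normal has `h = g`.) -/
def secondFundamentalForm {n m : ℕ} {M : Type*} [TopologicalSpace M]
    [ChartedSpace (EuclideanSpace ℝ (Fin n)) M]
    (X : M → EuclideanSpace ℝ (Fin m)) (ν : EuclideanSpace ℝ (Fin m)) (p : M)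
    (v w : TangentSpace (𝓡 n) p) : ℝ :=
  inner ℝ (fderiv ℝ (fderiv ℝ (X ∘ (extChartAt (𝓡 n) p).symm)) (extChartAt (𝓡 n) p p) v w) ν

/-- The `i`-th coordinate vector of the preferred chart at `p`. -/
def coordVector {n : ℕ} {M : Type*} [TopologicalSpace M]
    [ChartedSpace (EuclideanSpace ℝ (Fin n)) M] (p : M) (i : Fin n) : TangentSpace (𝓡 n) p :=
  (EuclideanSpace.single i (1 : ℝ) : EuclideanSpace ℝ (Fin n))

/-- The mean curvature at `p` with respect to the normal vector `ν`: the trace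
`H = ∑ g^{ij} h_{ij}` of the second fundamental form with respect to the induced metric (not
divided by `n`). -/
def meanCurvature {n m : ℕ} {M : Type*} [TopologicalSpace M]
    [ChartedSpace (EuclideanSpace ℝ (Fin n)) M]
    (X : M → EuclideanSpace ℝ (Fin m)) (ν : EuclideanSpace ℝ (Fin m)) (p : M) : ℝ :=
  Matrix.trace
    ((Matrix.of fun i j : Fin n => firstFundamentalForm X p (coordVector p i) (coordVector p j))⁻¹ *
      (Matrix.of fun i j : Fin n =>
        secondFundamentalForm X ν p (coordVector p i) (coordVector p j)))

/-- `X : M → ℝⁿ⁺¹`, with unit normal `N`, is a `λ`-hypersurface (with `l` for `λ`): `X` is a smooth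
immersion, each `N p` is a unit vector orthogonal to the tangent hyperplane `dX_p(T_p M)`, and
`⟨X, N⟩ + H = λ`, where `H` is the mean curvature with respect to `N`.
No continuity of `N` is asked for, so that an immersion of a non-orientable `M` with `λ = 0` is
covered too (changing the sign of `N p` changes that of `⟨X, N⟩ + H`, so for `λ ≠ 0` the equation
determines `N` and makes it smooth). -/
structure IsLambdaHypersurface {n : ℕ} {M : Type*} [TopologicalSpace M]
    [ChartedSpace (EuclideanSpace ℝ (Fin n)) M]
    (X N : M → EuclideanSpace ℝ (Fin (n + 1))) (l : ℝ) : Prop where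
  smooth : ContMDiff (𝓡 n) 𝓘(ℝ, EuclideanSpace ℝ (Fin (n + 1))) ∞ X
  immersion : ∀ p : M, Function.Injective (mvfderiv (𝓡 n) X p)
  norm_normal : ∀ p : M, ‖N p‖ = 1
  orthogonal : ∀ (p : M) (v : TangentSpace (𝓡 n) p), inner ℝ (mvfderiv (𝓡 n) X p v) (N p) = 0
  equation : ∀ p : M, inner ℝ (X p) (N p) + meanCurvature (n := n) X (N p) p = l

/-- `M`, with the metric induced by `X`, is isometric to the round sphere `Sⁿ(r)` of radius `r` in
`ℝⁿ⁺¹`. Here `Sⁿ(r)` is the standard smooth `n`-sphere with the metric induced by its embedding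
`y ↦ r y`, and an isometry is a diffeomorphism that preserves the metrics. -/
def IsIsometricToSphere {n : ℕ} {M : Type*} [TopologicalSpace M]
    [ChartedSpace (EuclideanSpace ℝ (Fin n)) M]
    (X : M → EuclideanSpace ℝ (Fin (n + 1))) (r : ℝ) : Prop :=
  ∃ Φ : M ≃ₘ^∞⟮𝓡 n, 𝓡 n⟯ (Metric.sphere (0 : EuclideanSpace ℝ (Fin (n + 1))) 1),
    ∀ (p : M) (v w : TangentSpace (𝓡 n) p),
      firstFundamentalForm
          (fun y : Metric.sphere (0 : EuclideanSpace ℝ (Fin (n + 1))) 1 =>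
            r • (y : EuclideanSpace ℝ (Fin (n + 1))))
          (Φ p) (mfderiv (𝓡 n) (𝓡 n) Φ p v) (mfderiv (𝓡 n) (𝓡 n) Φ p w) =
        firstFundamentalForm X p v w

end LambdaHypersurface

end

namespace LambdaHypersurface

open Filter Topology Set
open scoped MatrixOrder

/-! On the immersed hypersurface, the Laplacian of `‖X‖ ^ 2 / 2` is `n + H⟨X, N⟩`. Substituting `⟨X,
N⟩ = λ - H` and completing the square turns this into `n + λ²/4 - (H - λ/2)²`, so the pinching
hypothesis says exactly that `‖X‖ ^ 2` is subharmonic. By compactness and the strong maximum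
principle it is constant. The Laplacian then vanishes, which is the claimed equality, and `X` maps
`M` into a round sphere of radius `ρ > 0`.

The maximum principle is proved extrinsically. `second_derivative_test_of_isLocalMax` gives the sign
of the Laplacian at a local maximum of `a‖X‖² + ε exp(-α‖X - c‖²)`, and `eventually_norm_eq` runs
Hopf's barrier argument with these functions. Everything is evaluated at one point at a time, so `N`
need not be continuous.

The map `X / ρ` is a local homeomorphism from compact `M` to the unit sphere, hence a covering. For
`n ≥ 2` it is injective (`injective_of_isLocalHomeomorph_sphere`), so `M` is the sphere of radius
`ρ`. For `n = 1` it may wind `k` times around the circle; `M` is then a circle of radius `kρ`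
(`exists_isIsometricToSphere_of_circle`). -/

/-! ### Linear algebra of traces and the second derivative test -/

theorem trace_inv_mul_nonpos {ι : Type*} [Fintype ι] [DecidableEq ι] {G A : Matrix ι ι ℝ}
    (hG : G.PosDef) (hA : ∀ v : ι → ℝ, v ⬝ᵥ A.mulVec v ≤ 0) : (G⁻¹ * A).trace ≤ 0 := by
  -- Writing `G⁻¹ = Cᴴ C` turns the trace into the sum of the values of the quadratic form of `A` at
  -- the rows of `C`.
  obtain ⟨C, hC⟩ := CStarAlgebra.nonneg_iff_eq_star_mul_self.1 hG.inv.posSemidef.nonneg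
  rw [hC, Matrix.star_eq_conjTranspose, Matrix.mul_assoc, Matrix.trace_mul_comm]
  refine Finset.sum_nonpos fun i _ => ?_
  refine le_of_eq_of_le ?_ (hA (C i))
  simp only [Matrix.diag_apply, Matrix.mul_apply, Matrix.conjTranspose_apply, star_trivial,
    dotProduct, Matrix.mulVec, Finset.sum_mul, Finset.mul_sum]
  rw [Finset.sum_comm]
  simp only [mul_assoc]

/-- If `c` are the coordinates of the tangential part `z` of `y`, the vector of products `⟨y, x i⟩`
is `G c`, so the trace is `cᵀ G c = ‖z‖²`. This computes the squared gradient term of the barrier.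
-/
theorem trace_gram_inv_mul {ι E : Type*} [Fintype ι] [DecidableEq ι] [NormedAddCommGroup E]
    [InnerProductSpace ℝ E] {x : ι → E} (hx : LinearIndependent ℝ x) {y z ν : E}
    (hz : z ∈ Submodule.span ℝ (range x)) (hν : ∀ i, inner ℝ (x i) ν = 0)
    (hy : y = z + (inner ℝ y ν : ℝ) • ν) :
    ((Matrix.of fun i j => inner ℝ (x i) (x j))⁻¹ *
      (Matrix.of fun i j => inner ℝ y (x i) * inner ℝ y (x j))).trace =
      ‖y‖ ^ 2 - (inner ℝ y ν) ^ 2 := by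
  obtain ⟨c, rfl⟩ := (Submodule.mem_span_range_iff_exists_fun ℝ).1 hz
  set z := ∑ i, c i • x i with hz'
  set G : Matrix ι ι ℝ := Matrix.of fun i j => inner ℝ (x i) (x j) with hG
  have hGu : IsUnit G.det := by
    have := (Matrix.posDef_gram_of_linearIndependent hx).det_pos
    exact this.ne'.isUnit
  have hb : (fun i => (inner ℝ y (x i) : ℝ)) = G.mulVec c := by
    funext i
    rw [hy, inner_add_left, inner_smul_left, real_inner_comm, real_inner_comm (x i) ν, hν, hz',
      inner_sum]
    simp [hG, Matrix.mulVec, dotProduct, inner_smul_right, mul_comm]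
  have hB : (Matrix.of fun i j => (inner ℝ y (x i) * inner ℝ y (x j) : ℝ)) =
      Matrix.vecMulVec (fun i => inner ℝ y (x i)) (fun i => inner ℝ y (x i)) := rfl
  have hzν : (inner ℝ z ν : ℝ) = 0 := by
    rw [hz', sum_inner]
    exact Finset.sum_eq_zero fun i _ => by rw [inner_smul_left, hν, mul_zero]
  rw [hB, Matrix.mul_vecMulVec, Matrix.trace_vecMulVec]
  nth_rewrite 1 [hb]
  rw [Matrix.mulVec_mulVec, Matrix.nonsing_inv_mul _ hGu, Matrix.one_mulVec]
  have h1 : c ⬝ᵥ (fun i => (inner ℝ y (x i) : ℝ)) = inner ℝ y z := by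
    simp [hz', inner_sum, inner_smul_right, dotProduct]
  have h2 : (inner ℝ y y : ℝ) = inner ℝ y z + (inner ℝ y ν) ^ 2 := by
    calc (inner ℝ y y : ℝ) = inner ℝ y (z + (inner ℝ y ν : ℝ) • ν) := by rw [← hy]
      _ = _ := by rw [inner_add_right, inner_smul_right, sq]
  rw [h1, ← real_inner_self_eq_norm_sq, h2]
  ring

theorem second_derivative_test_along_curve {E : Type*} [NormedAddCommGroup E]
    [InnerProductSpace ℝ E] {γ γ₁ : ℝ → E} {γ₂ c : E} {a ε α : ℝ}
    (h₁ : ∀ᶠ t in 𝓝 0, HasDerivAt γ (γ₁ t) t) (h₂ : HasDerivAt γ₁ γ₂ 0)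
    (hmax : IsLocalMax (fun t => a * ‖γ t‖ ^ 2 + ε * Real.exp (-α * ‖γ t - c‖ ^ 2)) 0) :
    inner ℝ (γ₁ 0) ((2 * a) • γ 0 -
        (2 * α * (ε * Real.exp (-α * ‖γ 0 - c‖ ^ 2))) • (γ 0 - c)) = 0 ∧
      2 * a * (‖γ₁ 0‖ ^ 2 + inner ℝ (γ 0) γ₂) + ε * Real.exp (-α * ‖γ 0 - c‖ ^ 2) *
        (4 * α ^ 2 * (inner ℝ (γ 0 - c) (γ₁ 0)) ^ 2 -
          2 * α * (‖γ₁ 0‖ ^ 2 + inner ℝ (γ 0 - c) γ₂)) ≤ 0 := by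
  set f : ℝ → ℝ := fun t => a * ‖γ t‖ ^ 2 + ε * Real.exp (-α * ‖γ t - c‖ ^ 2) with hf
  have hd : ∀ t, HasDerivAt γ (γ₁ t) t → HasDerivAt f (2 * a * inner ℝ (γ t) (γ₁ t) +
      ε * (Real.exp (-α * ‖γ t - c‖ ^ 2) * (-α * (2 * inner ℝ (γ t - c) (γ₁ t))))) t := by
    intro t ht
    have := ((ht.norm_sq).const_mul a).add
      ((((ht.sub_const c).norm_sq.const_mul (-α)).exp).const_mul ε)
    refine this.congr_deriv ?_
    ring
  have hd' : deriv f =ᶠ[𝓝 0] fun t => 2 * a * inner ℝ (γ t) (γ₁ t) +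
      ε * (Real.exp (-α * ‖γ t - c‖ ^ 2) * (-α * (2 * inner ℝ (γ t - c) (γ₁ t)))) := by
    filter_upwards [h₁] with t ht using (hd t ht).deriv
  have h0 := h₁.self_of_nhds
  have hz := hmax.deriv_eq_zero
  rw [hd'.self_of_nhds] at hz
  refine ⟨?_, ?_⟩
  · rw [inner_sub_right, inner_smul_right, inner_smul_right, real_inner_comm,
      real_inner_comm (γ 0 - c)]
    linarith
  · have hdd : deriv (deriv f) 0 = 2 * a * (‖γ₁ 0‖ ^ 2 + inner ℝ (γ 0) γ₂) +
        ε * Real.exp (-α * ‖γ 0 - c‖ ^ 2) *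
        (4 * α ^ 2 * (inner ℝ (γ 0 - c) (γ₁ 0)) ^ 2 -
          2 * α * (‖γ₁ 0‖ ^ 2 + inner ℝ (γ 0 - c) γ₂)) := by
      rw [hd'.deriv_eq]
      have e1 := (h0.inner ℝ h₂).const_mul (2 * a)
      have e2 := (((((h0.sub_const c).norm_sq.const_mul (-α)).exp).mul
        ((((h0.sub_const c).inner ℝ h₂).const_mul 2).const_mul (-α))).const_mul ε)
      refine (e1.add e2).deriv.trans ?_
      rw [real_inner_self_eq_norm_sq]
      ring
    rw [← hdd]
    -- A positive second derivative would make `0` a local minimum as well, so `f` would be locally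
    -- constant and its second derivative zero.
    by_contra! hpos
    have hmin := isLocalMin_of_deriv_deriv_pos hpos (hd'.self_of_nhds.trans hz) 
      (hd 0 h0).continuousAt
    have hc : f =ᶠ[𝓝 0] fun _ => f 0 := by
      filter_upwards [hmax, hmin] with t h1 h2 using le_antisymm h1 h2
    have : deriv f =ᶠ[𝓝 0] fun _ => 0 := by
      filter_upwards [hc.eventuallyEq_nhds] with t ht
      rw [ht.deriv_eq, deriv_const]
    rw [this.deriv_eq, deriv_const] at hpos
    exact lt_irrefl _ hpos

theorem mem_span_of_orthogonal {n : ℕ} {ν z : EuclideanSpace ℝ (Fin (n + 1))}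
    {x : Fin n → EuclideanSpace ℝ (Fin (n + 1))} (hx : LinearIndependent ℝ x)
    (hν : ∀ i, inner ℝ (x i) ν = 0) (hν₀ : ν ≠ 0) (hz : inner ℝ z ν = 0) :
    z ∈ Submodule.span ℝ (range x) := by
  have h1 : Submodule.span ℝ (range x) ≤ (Submodule.span ℝ {ν})ᗮ := by
    rw [Submodule.span_le]
    rintro _ ⟨i, rfl⟩
    rw [SetLike.mem_coe, Submodule.mem_orthogonal_singleton_iff_inner_left]
    exact hν _
  have h2 : Module.finrank ℝ (Submodule.span ℝ (range x)) = n := by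
    rw [finrank_span_eq_card hx, Fintype.card_fin]
  have h3 : Module.finrank ℝ (Submodule.span ℝ {ν})ᗮ = n := by
    have : Fact (Module.finrank ℝ (EuclideanSpace ℝ (Fin (n + 1))) = n + 1) := ⟨by simp⟩
    exact Submodule.finrank_orthogonal_span_singleton hν₀
  rw [Submodule.eq_of_le_of_finrank_eq h1 (h2.trans h3.symm)]
  rwa [Submodule.mem_orthogonal_singleton_iff_inner_left]

/-- The trace, with respect to the metric pulled back by an injective linear map `L` onto the
hyperplane `νᗮ`, of a nonpositive quadratic form. -/
theorem trace_quadratic_form_nonpos {n : ℕ}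
    {L : EuclideanSpace ℝ (Fin n) →L[ℝ] EuclideanSpace ℝ (Fin (n + 1))}
    {Q : EuclideanSpace ℝ (Fin n) →L[ℝ] EuclideanSpace ℝ (Fin n) →L[ℝ]
      EuclideanSpace ℝ (Fin (n + 1))}
    {ν y D : EuclideanSpace ℝ (Fin (n + 1))} {a b : ℝ} (hL : Function.Injective L)
    (hν : ∀ v, inner ℝ (L v) ν = 0) (hn : ‖ν‖ = 1) (hD : ∀ v, inner ℝ (L v) D = 0)
    (h : ∀ v, a * ‖L v‖ ^ 2 + b * (inner ℝ y (L v)) ^ 2 + inner ℝ D (Q v v) ≤ 0) :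
    a * n + b * (‖y‖ ^ 2 - (inner ℝ y ν) ^ 2) + inner ℝ D ν *
      ((Matrix.of fun i j : Fin n => inner ℝ (L (EuclideanSpace.single i 1))
          (L (EuclideanSpace.single j 1)))⁻¹ *
        (Matrix.of fun i j : Fin n => inner ℝ (Q (EuclideanSpace.single i 1)
          (EuclideanSpace.single j 1)) ν)).trace ≤ 0 := by
  set e : Fin n → EuclideanSpace ℝ (Fin n) := fun i => EuclideanSpace.single i 1 with he
  set x : Fin n → EuclideanSpace ℝ (Fin (n + 1)) := fun i => L (e i) with hx
  have hν0 : ν ≠ 0 := norm_ne_zero_iff.1 (by rw [hn]; exact one_ne_zero)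
  have hνν : (inner ℝ ν ν : ℝ) = 1 := by rw [real_inner_self_eq_norm_sq, hn, one_pow]
  have hli : LinearIndependent ℝ x := by
    have h := (EuclideanSpace.basisFun (Fin n) ℝ).toBasis.linearIndependent.map'
      L.toLinearMap (LinearMap.ker_eq_bot.2 hL)
    have he : x = L.toLinearMap ∘ (EuclideanSpace.basisFun (Fin n) ℝ).toBasis := by
      funext i
      simp [hx, he]
    rw [he]
    exact h
  have hproj : ∀ z, z - (inner ℝ z ν : ℝ) • ν ∈ Submodule.span ℝ (range x) := fun z =>
    mem_span_of_orthogonal hli (fun i => hν _) hν0 (by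
      rw [inner_sub_left, inner_smul_left, hνν]
      simp)
  -- Being orthogonal to the tangent hyperplane, `D` sees only the normal part of `Q`. This is why
  -- no Christoffel symbols appear.
  have hDν : D = (inner ℝ D ν : ℝ) • ν := by
    have hzo : ∀ w ∈ Submodule.span ℝ (range x), inner ℝ w (D - (inner ℝ D ν : ℝ) • ν) = 0 := by
      intro w hw
      induction hw using Submodule.span_induction with
      | mem w hw =>
        obtain ⟨i, rfl⟩ := hw
        rw [inner_sub_right, inner_smul_right, hν, mul_zero, sub_zero, hD]
      | zero => exact inner_zero_left _
      | add u w _ _ hu hw => rw [inner_add_left, hu, hw, add_zero]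
      | smul r w _ hw => rw [inner_smul_left, hw, mul_zero]
    exact sub_eq_zero.1 (inner_self_eq_zero.1 (hzo _ (hproj D)))
  set κ : ℝ := inner ℝ D ν
  set G : Matrix (Fin n) (Fin n) ℝ := Matrix.of fun i j => inner ℝ (x i) (x j) with hG
  set B : Matrix (Fin n) (Fin n) ℝ :=
    Matrix.of fun i j => inner ℝ y (x i) * inner ℝ y (x j) with hB
  set S : Matrix (Fin n) (Fin n) ℝ := Matrix.of fun i j => inner ℝ (Q (e i) (e j)) ν with hS
  have hGpos : G.PosDef := Matrix.posDef_gram_of_linearIndependent hli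
  have htr := trace_inv_mul_nonpos (A := a • G + b • B + κ • S) hGpos ?_
  · have hGG : (G⁻¹ * G).trace = n := by
      rw [Matrix.nonsing_inv_mul _ hGpos.det_pos.ne'.isUnit, Matrix.trace_one, Fintype.card_fin]
    have hGB : (G⁻¹ * B).trace = ‖y‖ ^ 2 - (inner ℝ y ν) ^ 2 :=
      trace_gram_inv_mul hli (hproj y) (fun i => hν _) (by abel)
    simpa only [Matrix.mul_add, Matrix.mul_smul, Matrix.trace_add, Matrix.trace_smul, smul_eq_mul,
      hGG, hGB] using htr
  · intro v
    have hv := h (∑ i, v i • e i)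
    have e1 : L (∑ i, v i • e i) = ∑ i, v i • x i := by simp [hx]
    have hGv : v ⬝ᵥ G.mulVec v = ‖∑ i, v i • x i‖ ^ 2 := by
      rw [← real_inner_self_eq_norm_sq, ← Matrix.star_dotProduct_gram_mulVec]
      rfl
    have hBv : v ⬝ᵥ B.mulVec v = (inner ℝ y (∑ i, v i • x i)) ^ 2 := by
      rw [sq, inner_sum, Finset.sum_mul_sum]
      simp only [hB, Matrix.mulVec, dotProduct, inner_smul_right, Matrix.of_apply, Finset.mul_sum]
      refine Finset.sum_congr rfl fun i _ => Finset.sum_congr rfl fun j _ => ?_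
      ring
    have hSv : v ⬝ᵥ S.mulVec v = inner ℝ (Q (∑ i, v i • e i) (∑ i, v i • e i)) ν := by
      have e2 : Q (∑ i, v i • e i) (∑ i, v i • e i) =
          ∑ i, ∑ j, v i • v j • Q (e i) (e j) := by
        rw [map_sum Q, sum_apply]
        refine Finset.sum_congr rfl fun i _ => ?_
        rw [map_smul, smul_apply, map_sum, Finset.smul_sum]
        simp only [map_smul]
      simp only [e2, sum_inner, inner_smul_left, hS, Matrix.mulVec, dotProduct,
        Matrix.of_apply, Finset.mul_sum]
      refine Finset.sum_congr rfl fun i _ => Finset.sum_congr rfl fun j _ => ?_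
      simp only [conj_trivial]
      ring
    have hDw : inner ℝ D (Q (∑ i, v i • e i) (∑ i, v i • e i)) =
        κ * inner ℝ (Q (∑ i, v i • e i) (∑ i, v i • e i)) ν := by
      rw [hDν, inner_smul_left, real_inner_comm]
      rfl
    rw [e1, hDw] at hv
    simpa only [Matrix.add_mulVec, Matrix.smul_mulVec, dotProduct_add, dotProduct_smul,
      smul_eq_mul, hGv, hBv, hSv] using hv

/-! ### Immersions in charts and the Laplacian at a local maximum -/

section chart

variable {n m : ℕ} {M : Type*} [TopologicalSpace M] [ChartedSpace (EuclideanSpace ℝ (Fin n)) M]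

theorem fderiv_comp_extChartAt_symm {X : M → EuclideanSpace ℝ (Fin m)}
    (hX : ContMDiff (𝓡 n) 𝓘(ℝ, EuclideanSpace ℝ (Fin m)) ∞ X) (p : M)
    (v : EuclideanSpace ℝ (Fin n)) :
    fderiv ℝ (X ∘ (extChartAt (𝓡 n) p).symm) (extChartAt (𝓡 n) p p) v =
      mvfderiv (𝓡 n) X p v := by
  have h := (hX.mdifferentiableAt (x := p) (by simp)).mvfderiv
  rw [h]
  simp only [ModelWithCorners.range_eq_univ, fderivWithin_univ]
  rfl

variable [IsManifold (𝓡 n) ∞ M]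

theorem contDiffOn_comp_extChartAt_symm {X : M → EuclideanSpace ℝ (Fin m)}
    (hX : ContMDiff (𝓡 n) 𝓘(ℝ, EuclideanSpace ℝ (Fin m)) ∞ X) (p : M) :
    ContDiffOn ℝ ∞ (X ∘ (extChartAt (𝓡 n) p).symm) (extChartAt (𝓡 n) p).target :=
  (hX.comp_contMDiffOn (contMDiffOn_extChartAt_symm p)).contDiffOn

theorem contDiffAt_comp_extChartAt_symm {X : M → EuclideanSpace ℝ (Fin m)}
    (hX : ContMDiff (𝓡 n) 𝓘(ℝ, EuclideanSpace ℝ (Fin m)) ∞ X) (p : M)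
    {x : EuclideanSpace ℝ (Fin n)} (hx : x ∈ (extChartAt (𝓡 n) p).target) :
    ContDiffAt ℝ ∞ (X ∘ (extChartAt (𝓡 n) p).symm) x :=
  (contDiffOn_comp_extChartAt_symm hX p).contDiffAt ((isOpen_extChartAt_target p).mem_nhds hx)

theorem fderiv_comp_extChartAt_symm_mem_range {X : M → EuclideanSpace ℝ (Fin m)}
    (hX : ContMDiff (𝓡 n) 𝓘(ℝ, EuclideanSpace ℝ (Fin m)) ∞ X) (p : M)
    {x : EuclideanSpace ℝ (Fin n)} (hx : x ∈ (extChartAt (𝓡 n) p).target)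
    (v : EuclideanSpace ℝ (Fin n)) :
    ∃ w, fderiv ℝ (X ∘ (extChartAt (𝓡 n) p).symm) x v =
      mvfderiv (𝓡 n) X ((extChartAt (𝓡 n) p).symm x) w := by
  have h1 : MDifferentiableAt 𝓘(ℝ, EuclideanSpace ℝ (Fin n)) (𝓡 n) (extChartAt (𝓡 n) p).symm x :=
    ((contMDiffOn_extChartAt_symm (n := ∞) p).contMDiffAt
      ((isOpen_extChartAt_target p).mem_nhds hx)).mdifferentiableAt (by simp)
  have h2 := hX.mdifferentiableAt (x := (extChartAt (𝓡 n) p).symm x) (by simp)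
  refine ⟨mfderiv 𝓘(ℝ, EuclideanSpace ℝ (Fin n)) (𝓡 n) (extChartAt (𝓡 n) p).symm x v, ?_⟩
  rw [← mfderiv_eq_fderiv]
  exact mfderiv_comp_apply x h2 h1 v

/-- The left side is the Laplacian of the test function at `q`. It is the metric trace of the second
derivatives along lines of the chart; `D` is the ambient gradient, which is normal to the
hypersurface because `q` is critical. -/
theorem second_derivative_test_of_isLocalMax {X N : M → EuclideanSpace ℝ (Fin (n + 1))} {l : ℝ}
    (hX : IsLambdaHypersurface X N l) {c : EuclideanSpace ℝ (Fin (n + 1))} {a ε α : ℝ} {q : M}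
    (hmax : IsLocalMax (fun p => a * ‖X p‖ ^ 2 + ε * Real.exp (-α * ‖X p - c‖ ^ 2)) q) :
    2 * a * (n + meanCurvature (n := n) X (N q) q * inner ℝ (X q) (N q)) +
      ε * Real.exp (-α * ‖X q - c‖ ^ 2) *
        (4 * α ^ 2 * (‖X q - c‖ ^ 2 - (inner ℝ (X q - c) (N q)) ^ 2) -
          2 * α * (n + meanCurvature (n := n) X (N q) q * inner ℝ (X q - c) (N q))) ≤ 0 := by
  set φ := extChartAt (𝓡 n) q with hφ
  set F := X ∘ φ.symm with hF
  set y := X q - c with hy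
  set η := ε * Real.exp (-α * ‖y‖ ^ 2) with hη
  set D := (2 * a) • X q - (2 * α * η) • y with hD
  have hx0 : φ q ∈ φ.target := mem_extChartAt_target q
  have hFq : F (φ q) = X q := by simp [hF, hφ]
  have hFd : ∀ᶠ x in 𝓝 (φ q), HasFDerivAt F (fderiv ℝ F x) x := by
    filter_upwards [(isOpen_extChartAt_target q).mem_nhds hx0] with x hx
    exact ((contDiffAt_comp_extChartAt_symm hX.smooth q hx).differentiableAt
      (by simp)).hasFDerivAt
  have hF2 : HasFDerivAt (fderiv ℝ F) (fderiv ℝ (fderiv ℝ F) (φ q)) (φ q) :=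
    (((contDiffAt_comp_extChartAt_symm hX.smooth q hx0).fderiv_right (m := 1)
      (by norm_cast)).differentiableAt (by simp)).hasFDerivAt
  have key : ∀ v : EuclideanSpace ℝ (Fin n),
      inner ℝ (fderiv ℝ F (φ q) v) D = 0 ∧
      2 * a * (‖fderiv ℝ F (φ q) v‖ ^ 2 + inner ℝ (X q) (fderiv ℝ (fderiv ℝ F) (φ q) v v)) +
        η * (4 * α ^ 2 * (inner ℝ y (fderiv ℝ F (φ q) v)) ^ 2 -
          2 * α * (‖fderiv ℝ F (φ q) v‖ ^ 2 +
            inner ℝ y (fderiv ℝ (fderiv ℝ F) (φ q) v v))) ≤ 0 := by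
    intro v
    have hline : ∀ t : ℝ, HasDerivAt (fun t : ℝ => φ q + t • v) v t := fun t => by
      simpa using ((hasDerivAt_id t).smul_const v).const_add (φ q)
    have h0 : φ q + (0 : ℝ) • v = φ q := by simp
    have hcont : Tendsto (fun t : ℝ => φ q + t • v) (𝓝 0) (𝓝 (φ q)) := by
      simpa using (hline 0).continuousAt.tendsto
    have h := second_derivative_test_along_curve (γ := fun t : ℝ => F (φ q + t • v))
      (γ₁ := fun t => fderiv ℝ F (φ q + t • v) v)
      (γ₂ := fderiv ℝ (fderiv ℝ F) (φ q) v v) (c := c) (a := a) (ε := ε) (α := α)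
      ?_ ?_ ?_
    · simpa only [h0, hFq] using h
    · filter_upwards [hcont.eventually hFd] with t ht
      exact ht.comp_hasDerivAt t (hline t)
    · have h1 : HasDerivAt (fun t : ℝ => fderiv ℝ F (φ q + t • v))
          (fderiv ℝ (fderiv ℝ F) (φ q) v) 0 := by
        have h2 : HasFDerivAt (fderiv ℝ F) (fderiv ℝ (fderiv ℝ F) (φ q)) (φ q + (0 : ℝ) • v) := by
          rwa [h0]
        exact h2.comp_hasDerivAt (0 : ℝ) (hline 0)
      exact (ContinuousLinearMap.apply ℝ _ v).hasFDerivAt.comp_hasDerivAt (0 : ℝ) h1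
    · have h1 : Tendsto (fun t : ℝ => φ.symm (φ q + t • v)) (𝓝 0) (𝓝 q) := by
        have := (continuousAt_extChartAt_symm (I := 𝓡 n) q).tendsto.comp hcont
        rwa [extChartAt_to_inv] at this
      have h2 := h1.eventually hmax
      filter_upwards [h2] with t ht
      simpa [hF, hφ] using ht
  have hL : ∀ v : EuclideanSpace ℝ (Fin n), mvfderiv (𝓡 n) X q v = fderiv ℝ F (φ q) v :=
    fun v => (fderiv_comp_extChartAt_symm hX.smooth q v).symm
  have hH : meanCurvature (n := n) X (N q) q =
      ((Matrix.of fun i j : Fin n => inner ℝ (fderiv ℝ F (φ q) (EuclideanSpace.single i 1))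
          (fderiv ℝ F (φ q) (EuclideanSpace.single j 1)))⁻¹ *
        (Matrix.of fun i j : Fin n => inner ℝ (fderiv ℝ (fderiv ℝ F) (φ q)
          (EuclideanSpace.single i 1) (EuclideanSpace.single j 1)) (N q))).trace := by
    simp only [← hL]
    rfl
  have hκ : (inner ℝ D (N q) : ℝ) =
      2 * a * inner ℝ (X q) (N q) - 2 * α * η * inner ℝ y (N q) := by
    rw [hD, inner_sub_left, inner_smul_left, inner_smul_left]
    simp
  have htr := trace_quadratic_form_nonpos (L := fderiv ℝ F (φ q))
    (Q := fderiv ℝ (fderiv ℝ F) (φ q)) (ν := N q) (y := y) (D := D)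
    (a := 2 * a - 2 * α * η) (b := 4 * α ^ 2 * η)
    (fun v w hvw => hX.immersion q (by rw [hL v, hL w, hvw]))
    (fun v => by rw [← hL]; exact hX.orthogonal q v) (hX.norm_normal q) (fun v => (key v).1)
    (fun v => by
      have h := (key v).2
      have e : (inner ℝ D (fderiv ℝ (fderiv ℝ F) (φ q) v v) : ℝ) =
          2 * a * inner ℝ (X q) (fderiv ℝ (fderiv ℝ F) (φ q) v v) -
            2 * α * η * inner ℝ y (fderiv ℝ (fderiv ℝ F) (φ q) v v) := by
        rw [hD, inner_sub_left, inner_smul_left, inner_smul_left]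
        simp only [conj_trivial]
      rw [e]
      linarith)
  rw [← hH, hκ] at htr
  linarith

end chart

/-! ### Two local estimates for the barrier argument -/

/-- Short chords of an immersion are nearly tangent. With `‖v‖ ≤ K‖L v‖` and errors of size
`1/(5K)`, one gets `‖x - y‖ ≤ (5/4)K‖F x - F y‖`. The linearization error and the variation of the
derivative then each cost at most a quarter of the chord. -/
theorem exists_mem_nhds_approximates {V E : Type*} [NormedAddCommGroup V] [NormedSpace ℝ V]
    [FiniteDimensional ℝ V] [NormedAddCommGroup E] [InnerProductSpace ℝ E] {F : V → E} {x₀ : V}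
    (hF : ContDiffAt ℝ 1 F x₀) (hinj : Function.Injective (fderiv ℝ F x₀)) :
    ∃ s ∈ 𝓝 x₀, ∀ x ∈ s, ∀ y ∈ s, (F x = F y → x = y) ∧
      ∀ ν : E, ‖ν‖ = 1 → (∀ v, inner ℝ (fderiv ℝ F x v) ν = 0) →
        |inner ℝ (F x - F y) ν| ≤ 1 / 2 * ‖F x - F y‖ := by
  set L := fderiv ℝ F x₀ with hL
  obtain ⟨K, hK, hKL⟩ := L.toLinearMap.exists_antilipschitzWith (LinearMap.ker_eq_bot.2 hinj)
  have hK' : (0 : ℝ) < K := hK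
  have hanti : ∀ v, ‖v‖ ≤ K * ‖L v‖ := fun v => by
    simpa using hKL.le_mul_dist v 0
  obtain ⟨s, hs, hsF⟩ := (hF.hasStrictFDerivAt (by simp)).approximates_deriv_on_nhds
    (c := (5 * K)⁻¹) (Or.inr (by positivity))
  have hcont : ∀ᶠ x in 𝓝 x₀, ‖fderiv ℝ F x - L‖ < (5 * K : ℝ)⁻¹ := by
    have h := (hF.continuousAt_fderiv (by simp)).tendsto
    have h' := (tendsto_iff_norm_sub_tendsto_zero.1 h)
    exact h'.eventually_lt_const (by positivity)
  refine ⟨s ∩ {x | ‖fderiv ℝ F x - L‖ < (5 * K : ℝ)⁻¹}, inter_mem hs hcont, ?_⟩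
  rintro x ⟨hx, hxL⟩ y ⟨hy, -⟩
  have h1 : ‖F x - F y - L (x - y)‖ ≤ (5 * K : ℝ)⁻¹ * ‖x - y‖ := by
    simpa using hsF x hx y hy
  have h2 := hanti (x - y)
  have h3 : ‖L (x - y)‖ ≤ ‖F x - F y‖ + (5 * K : ℝ)⁻¹ * ‖x - y‖ := by
    have := norm_sub_norm_le (L (x - y)) (F x - F y)
    rw [norm_sub_rev (L (x - y))] at this
    linarith
  have h4 : ‖x - y‖ ≤ 5 / 4 * K * ‖F x - F y‖ := by
    have : K * ‖L (x - y)‖ ≤ K * ‖F x - F y‖ + 1 / 5 * ‖x - y‖ := by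
      calc K * ‖L (x - y)‖ ≤ K * (‖F x - F y‖ + (5 * K : ℝ)⁻¹ * ‖x - y‖) := by gcongr
        _ = _ := by field_simp
    linarith
  refine ⟨fun hxy => ?_, fun ν hν hort => ?_⟩
  · rw [hxy, sub_self, norm_zero, mul_zero] at h4
    exact sub_eq_zero.1 (norm_le_zero_iff.1 h4)
  · have e : (inner ℝ (F x - F y) ν : ℝ) =
        inner ℝ (F x - F y - L (x - y)) ν - inner ℝ ((fderiv ℝ F x - L) (x - y)) ν := by
      simp only [sub_apply, inner_sub_left, hort]
      ring
    have h5 := abs_real_inner_le_norm (F x - F y - L (x - y)) ν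
    have h6 := abs_real_inner_le_norm ((fderiv ℝ F x - L) (x - y)) ν
    rw [hν, mul_one] at h5 h6
    have h7 : ‖(fderiv ℝ F x - L) (x - y)‖ ≤ (5 * K : ℝ)⁻¹ * ‖x - y‖ :=
      (ContinuousLinearMap.le_opNorm _ _).trans (by gcongr; exact hxL.le)
    have h8 : (5 * K : ℝ)⁻¹ * ‖x - y‖ ≤ 1 / 4 * ‖F x - F y‖ := by
      calc (5 * K : ℝ)⁻¹ * ‖x - y‖ ≤ (5 * K : ℝ)⁻¹ * (5 / 4 * K * ‖F x - F y‖) := by gcongr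
        _ = _ := by field_simp
    rw [e]
    exact (abs_sub _ _).trans (by linarith)

/-- Where `e ≥ e₀`, compactness gives a gap `u₀ - u ≥ δ`, and `ε = δ / 2` is too small to close it
since `e ≤ 1`. Elsewhere both summands already compare correctly. -/
theorem exists_pos_forall_add_lt {T : Type*} [TopologicalSpace T] {K : Set T} (hK : IsCompact K)
    {u e : T → ℝ} (hu : Continuous u) (he : Continuous e) {u₀ e₀ : ℝ} (he₀ : 0 < e₀)
    (he₁ : ∀ q, e q ≤ 1) (hle : ∀ q ∈ K, u q ≤ u₀) (hlt : ∀ q ∈ K, u q = u₀ → e q < e₀) :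
    ∃ ε > 0, ∀ q ∈ K, u q + ε * e q < u₀ + ε * e₀ := by
  have hK1 : IsCompact (K ∩ {q | e₀ ≤ e q}) := hK.inter_right (isClosed_le continuous_const he)
  obtain ⟨δ, hδ, h⟩ := hK1.exists_forall_le' (f := fun q => u₀ - u q) (a := 0)
    (continuous_const.sub hu).continuousOn fun q hq => by
      have h1 := hle q hq.1
      rcases h1.eq_or_lt with h2 | h2
      · exact absurd (hlt q hq.1 h2) (not_lt.2 hq.2)
      · linarith
  refine ⟨δ / 2, by positivity, fun q hq => ?_⟩
  by_cases hq' : e₀ ≤ e q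
  · have h1 := h q ⟨hq, hq'⟩
    have h2 : δ / 2 * e q ≤ δ / 2 * 1 := by gcongr; exact he₁ q
    have h3 : 0 < δ / 2 * e₀ := by positivity
    linarith
  · have h1 := hle q hq
    have h2 : δ / 2 * e q < δ / 2 * e₀ := by gcongr; exact not_le.1 hq'
    linarith

/-! ### The strong maximum principle for the squared norm -/

section maximum_principle

variable {n : ℕ} {M : Type*} [TopologicalSpace M] [ChartedSpace (EuclideanSpace ℝ (Fin n)) M]
  {X N : M → EuclideanSpace ℝ (Fin (n + 1))} {l : ℝ}

theorem IsLambdaHypersurface.nat_add_meanCurvature_mul_inner (hX : IsLambdaHypersurface X N l)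
    (p : M) : n + meanCurvature (n := n) X (N p) p * inner ℝ (X p) (N p) =
      n + l ^ 2 / 4 - (meanCurvature (n := n) X (N p) p - l / 2) ^ 2 := by
  have h := hX.equation p
  rw [← h]
  ring

variable [IsManifold (𝓡 n) ∞ M]

theorem IsLambdaHypersurface.exists_mem_nhds_abs_inner_le (hX : IsLambdaHypersurface X N l)
    (q₀ : M) : ∃ U ∈ 𝓝 q₀, ∀ q ∈ U, ∀ p ∈ U, (X q = X p → q = p) ∧
      |inner ℝ (X q - X p) (N q)| ≤ 1 / 2 * ‖X q - X p‖ := by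
  set φ := extChartAt (𝓡 n) q₀ with hφ
  have hL : ∀ v : EuclideanSpace ℝ (Fin n),
      mvfderiv (𝓡 n) X q₀ v = fderiv ℝ (X ∘ φ.symm) (φ q₀) v :=
    fun v => (fderiv_comp_extChartAt_symm hX.smooth q₀ v).symm
  obtain ⟨s, hs, h⟩ := exists_mem_nhds_approximates
    ((contDiffAt_comp_extChartAt_symm hX.smooth q₀ (mem_extChartAt_target q₀)).of_le
      (by norm_cast)) (fun v w hvw => hX.immersion q₀ (by rw [hL v, hL w]; exact hvw))
  refine ⟨φ.source ∩ φ ⁻¹' s, inter_mem (extChartAt_source_mem_nhds q₀)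
    ((continuousAt_extChartAt q₀).preimage_mem_nhds hs), ?_⟩
  rintro q ⟨hq, hqs⟩ p ⟨hp, hps⟩
  obtain ⟨h1, h2⟩ := h _ hqs _ hps
  have eq : (X ∘ φ.symm) (φ q) = X q := by simp [φ.left_inv hq]
  have ep : (X ∘ φ.symm) (φ p) = X p := by simp [φ.left_inv hp]
  rw [eq, ep] at h1 h2
  refine ⟨fun hqp => φ.injOn hq hp (h1 hqp), h2 (N q) (hX.norm_normal q) fun v => ?_⟩
  obtain ⟨w, hw⟩ := fderiv_comp_extChartAt_symm_mem_range hX.smooth q₀ (φ.map_source hq) v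
  rw [hw, φ.left_inv hq]
  exact hX.orthogonal q w

/-- Hopf's argument with ambient balls in place of geodesic ones. A ball around a nearby non-maximal
value `X p` is enlarged until it touches the maximum set at `q₀`. A barrier centred midway then
yields an interior maximum at which the Laplacian is positive. -/
theorem IsLambdaHypersurface.eventually_norm_eq [T2Space M] [CompactSpace M]
    (hX : IsLambdaHypersurface X N l)
    (hH : ∀ p : M, (meanCurvature (n := n) X (N p) p - l / 2) ^ 2 ≤ n + l ^ 2 / 4)
    {q₁ : M} (hmax : ∀ p, ‖X p‖ ≤ ‖X q₁‖) : ∀ᶠ p in 𝓝 q₁, ‖X p‖ = ‖X q₁‖ := by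
  by_contra hne
  have hXc : Continuous X := hX.smooth.continuous
  obtain ⟨U, hU, hUX⟩ := hX.exists_mem_nhds_abs_inner_le q₁
  obtain ⟨C, hC, hCc, hCU⟩ := exists_mem_nhds_isClosed_subset hU
  have hq₁ : q₁ ∈ interior C := mem_interior_iff_mem_nhds.2 hC
  have hq₁C : q₁ ∈ C := interior_subset hq₁
  obtain ⟨δ, hδ, hδC⟩ := (hCc.isCompact.diff isOpen_interior).exists_forall_le'
    (f := fun q => ‖X q - X q₁‖) (a := 0) (by fun_prop) (s := C \ interior C) fun q hq => by
      rw [norm_pos_iff, sub_ne_zero]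
      intro h
      exact hq.2 ((hUX q (hCU hq.1) q₁ (hCU hq₁C)).1 h ▸ hq₁)
  -- The bound `δ / 3` keeps the closest maximum point `q₀` off the boundary of `C`: it lies within
  -- `2δ / 3` of `q₁` in the ambient distance.
  obtain ⟨p, hpm, hpC, hpδ⟩ := ((not_eventually.1 hne).and_eventually
    ((eventually_mem_set.2 hC).and ((show Continuous fun p => ‖X p - X q₁‖ by fun_prop).tendsto q₁
      |>.eventually_lt_const (u := δ / 3) (by simpa using by positivity)))).exists
  obtain ⟨q₀, ⟨hq₀C, hq₀m⟩, hq₀min⟩ := (hCc.isCompact.inter_right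
    (isClosed_eq (continuous_norm.comp hXc) (continuous_const (y := ‖X q₁‖)))).exists_isMinOn
    ⟨q₁, hq₁C, rfl⟩ (f := fun q => ‖X q - X p‖) (by fun_prop)
  have hq₀m' : ‖X q₀‖ = ‖X q₁‖ := hq₀m
  have hmin : ∀ q ∈ C, ‖X q‖ = ‖X q₁‖ → ‖X q₀ - X p‖ ≤ ‖X q - X p‖ :=
    fun q hq hqm => hq₀min ⟨hq, hqm⟩
  set R := ‖X q₀ - X p‖ with hR
  have hRpos : 0 < R := by
    rw [hR, norm_pos_iff, sub_ne_zero]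
    intro h
    exact hpm (by rw [← h, hq₀m'])
  have hq₀int : q₀ ∈ interior C := by
    by_contra h
    have h1 := hδC q₀ ⟨hq₀C, h⟩
    have h2 := hmin q₁ hq₁C rfl
    have h3 := norm_sub_le_norm_sub_add_norm_sub (X q₀) (X p) (X q₁)
    rw [norm_sub_rev (X q₁)] at h2
    linarith
  -- The ball of radius `R / 2` about `c` is internally tangent at `X q₀` to the ball of radius `R`
  -- about `X p`. Hence every other maximum point in `C` is strictly farther from `c` than `q₀` is.
  set c := (1 / 2 : ℝ) • (X p + X q₀) with hc
  have hsplit : ∀ q, X q - c = (1 / 2 : ℝ) • (X q - X p) + (1 / 2 : ℝ) • (X q - X q₀) := by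
    intro q
    rw [hc]
    module
  have hq₀c : ‖X q₀ - c‖ = R / 2 := by
    rw [hsplit, sub_self, smul_zero, add_zero, norm_smul, ← hR]
    norm_num
    ring
  have hpar : ∀ q, ‖X q - c‖ ^ 2 =
      1 / 2 * ‖X q - X p‖ ^ 2 + 1 / 2 * ‖X q - X q₀‖ ^ 2 - 1 / 4 * R ^ 2 := by
    intro q
    have h1 := parallelogram_law_with_norm ℝ (X q - X p) (X q - X q₀)
    rw [sub_sub_sub_cancel_left, ← hR] at h1
    rw [hsplit, ← smul_add, norm_smul, mul_pow]
    norm_num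
    linarith
  obtain ⟨B, hB, hBc, hBsub⟩ := exists_mem_nhds_isClosed_subset (X := M) (x := q₀)
    (s := interior C ∩ {q | ‖X q - X q₀‖ < R / 8})
    (inter_mem (isOpen_interior.mem_nhds hq₀int)
      ((show Continuous fun p => ‖X p - X q₀‖ by fun_prop).tendsto q₀
        |>.eventually_lt_const (by simpa using by positivity)))
  have hq₀B : q₀ ∈ interior B := mem_interior_iff_mem_nhds.2 hB
  set H₀ := √(n + l ^ 2 / 4) + |l| / 2 with hH₀
  -- The bound on `H` comes from the pinching hypothesis, since continuity of `H` is not available.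
  have hHle : ∀ q, |meanCurvature (n := n) X (N q) q| ≤ H₀ := by
    intro q
    have h1 := Real.abs_le_sqrt (hH q)
    have h2 := abs_add_le (meanCurvature (n := n) X (N q) q - l / 2) (l / 2)
    rw [sub_add_cancel, abs_div, abs_two] at h2
    linarith
  have hH₀nn : 0 ≤ H₀ := by positivity
  -- On `B`, `‖X q - c‖ ≥ 3R/8`, and its normal component is at most `5R/16`, `X q - c` being half
  -- the sum of two nearly tangent chords. The difference of the squares is `11R²/256`.
  set τ := 11 / 256 * R ^ 2 with hτ
  have hτpos : 0 < τ := by positivity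
  -- This makes the `α²` term of the Laplacian of the barrier dominate the term linear in `α`
  -- throughout `B`.
  set α := (n + H₀ * R) / (2 * τ) + 1 with hα
  have hαpos : 0 < α := by positivity
  have hαlarge : n + H₀ * R < 2 * α * τ := by
    have : 2 * α * τ = n + H₀ * R + 2 * τ := by
      rw [hα]
      field_simp
    linarith
  obtain ⟨ε, hε, hεB⟩ := exists_pos_forall_add_lt (K := B \ interior B)
    (hBc.isCompact.diff isOpen_interior) (u := fun q => ‖X q‖ ^ 2)
    (e := fun q => Real.exp (-α * ‖X q - c‖ ^ 2)) (by fun_prop) (by fun_prop)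
    (u₀ := ‖X q₁‖ ^ 2) (e₀ := Real.exp (-α * ‖X q₀ - c‖ ^ 2)) (Real.exp_pos _)
    (fun q => Real.exp_le_one_iff.2 (by
      rw [neg_mul]
      exact neg_nonpos.2 (by positivity)))
    (fun q _ => by gcongr; exact hmax q) (fun q hq hqm => by
      have hqm' : ‖X q‖ = ‖X q₁‖ := (sq_eq_sq₀ (norm_nonneg _) (norm_nonneg _)).1 hqm
      have hqC : q ∈ C := interior_subset (hBsub hq.1).1
      have h1 := hmin q hqC hqm'
      have h2 : 0 < ‖X q - X q₀‖ := by
        rw [norm_pos_iff, sub_ne_zero]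
        intro h
        exact hq.2 ((hUX q (hCU hqC) q₀ (hCU hq₀C)).1 h ▸ hq₀B)
      have h3 : R ^ 2 ≤ ‖X q - X p‖ ^ 2 := by gcongr
      have h4 : ‖X q₀ - c‖ ^ 2 < ‖X q - c‖ ^ 2 := by
        rw [hq₀c, hpar]
        have : 0 < ‖X q - X q₀‖ ^ 2 := by positivity
        linarith
      rw [Real.exp_lt_exp, neg_mul, neg_mul, neg_lt_neg_iff]
      gcongr)
  obtain ⟨q, hqB, hqmax⟩ := hBc.isCompact.exists_isMaxOn ⟨q₀, interior_subset hq₀B⟩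
    (f := fun q => 1 * ‖X q‖ ^ 2 + ε * Real.exp (-α * ‖X q - c‖ ^ 2)) (by fun_prop)
  have hqint : q ∈ interior B := by
    by_contra h
    have h1 := hεB q ⟨hqB, h⟩
    have h2 : 1 * ‖X q₀‖ ^ 2 + ε * Real.exp (-α * ‖X q₀ - c‖ ^ 2) ≤
      1 * ‖X q‖ ^ 2 + ε * Real.exp (-α * ‖X q - c‖ ^ 2) := hqmax (interior_subset hq₀B)
    rw [hq₀m'] at h2
    linarith
  have key := second_derivative_test_of_isLocalMax hX
    (hqmax.isLocalMax (mem_interior_iff_mem_nhds.1 hqint))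
  obtain ⟨hqC, hqR⟩ := hBsub hqB
  have hqR' : ‖X q - X q₀‖ < R / 8 := hqR
  have hqU := hCU (interior_subset hqC)
  have h1 := (hUX q hqU p (hCU hpC)).2
  have h2 := (hUX q hqU q₀ (hCU hq₀C)).2
  have h3 : ‖X q - X p‖ ≤ R + R / 8 := by
    have := norm_sub_le_norm_sub_add_norm_sub (X q) (X q₀) (X p)
    linarith
  have hyN : |inner ℝ (X q - c) (N q)| ≤ 5 / 16 * R := by
    rw [hsplit, inner_add_left, inner_smul_left, inner_smul_left]
    refine (abs_add_le _ _).trans ?_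
    rw [abs_mul, abs_mul]
    norm_num
    linarith
  have hylow : 3 / 8 * R ≤ ‖X q - c‖ := by
    have := norm_sub_le_norm_sub_add_norm_sub (X q₀) (X q) c
    rw [norm_sub_rev (X q₀) (X q)] at this
    linarith
  have hT : τ ≤ ‖X q - c‖ ^ 2 - (inner ℝ (X q - c) (N q)) ^ 2 := by
    have h4 : (3 / 8 * R) ^ 2 ≤ ‖X q - c‖ ^ 2 := by gcongr
    have h5 : (inner ℝ (X q - c) (N q)) ^ 2 ≤ (5 / 16 * R) ^ 2 :=
      sq_le_sq' (abs_le.1 hyN).1 (abs_le.1 hyN).2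
    rw [hτ]
    linarith
  have hHy : meanCurvature (n := n) X (N q) q * inner ℝ (X q - c) (N q) ≤ H₀ * R := by
    refine (le_abs_self _).trans ?_
    rw [abs_mul]
    exact mul_le_mul (hHle q) (hyN.trans (by linarith)) (abs_nonneg _) hH₀nn
  have hfirst := hX.nat_add_meanCurvature_mul_inner q
  have hsecond := hH q
  have hη : 0 < ε * Real.exp (-α * ‖X q - c‖ ^ 2) := by positivity
  have hbr : 0 < 4 * α ^ 2 * (‖X q - c‖ ^ 2 - (inner ℝ (X q - c) (N q)) ^ 2) -
      2 * α * (n + meanCurvature (n := n) X (N q) q * inner ℝ (X q - c) (N q)) := by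
    have h6 : 4 * α ^ 2 * τ ≤
        4 * α ^ 2 * (‖X q - c‖ ^ 2 - (inner ℝ (X q - c) (N q)) ^ 2) := by gcongr
    have h7 : 2 * α * (n + meanCurvature (n := n) X (N q) q * inner ℝ (X q - c) (N q)) ≤
        2 * α * (n + H₀ * R) := by gcongr
    have h8 : 2 * α * (n + H₀ * R) < 2 * α * (2 * α * τ) := by gcongr
    linarith
  have := mul_pos hη hbr
  linarith

theorem IsLambdaHypersurface.exists_norm_eq [T2Space M] [CompactSpace M] [ConnectedSpace M]
    (hX : IsLambdaHypersurface X N l)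
    (hH : ∀ p : M, (meanCurvature (n := n) X (N p) p - l / 2) ^ 2 ≤ n + l ^ 2 / 4) :
    ∃ ρ : ℝ, ∀ p, ‖X p‖ = ρ := by
  have hXc : Continuous X := hX.smooth.continuous
  obtain ⟨q₁, -, hq₁⟩ := isCompact_univ.exists_isMaxOn (univ_nonempty (α := M))
    (f := fun q => ‖X q‖) (by fun_prop)
  have hcl : IsClopen {p | ‖X p‖ = ‖X q₁‖} := by
    refine ⟨isClosed_eq (by fun_prop) continuous_const, isOpen_iff_mem_nhds.2 fun p hp => ?_⟩
    have hp' : ‖X p‖ = ‖X q₁‖ := hp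
    have := hX.eventually_norm_eq hH (q₁ := p) fun q => hp' ▸ hq₁ (mem_univ q)
    filter_upwards [this] with q hq using hq.trans hp'
  have := hcl.eq_univ ⟨q₁, rfl⟩
  exact ⟨‖X q₁‖, fun p => (this ▸ mem_univ p : p ∈ {p | ‖X p‖ = ‖X q₁‖})⟩

/-- When the norm is constant, every point is a local maximum of `a‖X‖²` for both signs of `a`, so
the Laplacian vanishes. -/
theorem IsLambdaHypersurface.sq_eq_of_norm_eq (hX : IsLambdaHypersurface X N l) {ρ : ℝ}
    (hρ : ∀ p, ‖X p‖ = ρ) (p : M) :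
    (meanCurvature (n := n) X (N p) p - l / 2) ^ 2 = n + l ^ 2 / 4 := by
  have h : ∀ a : ℝ, 2 * a * (n + meanCurvature (n := n) X (N p) p * inner ℝ (X p) (N p)) ≤ 0 := by
    intro a
    have hmax : IsLocalMax (fun q => a * ‖X q‖ ^ 2 + 0 * Real.exp (-0 * ‖X q - 0‖ ^ 2)) p :=
      Eventually.of_forall fun q => by simp [hρ]
    simpa using second_derivative_test_of_isLocalMax hX hmax
  have h1 := h 1
  have h2 := h (-1)
  have h3 := hX.nat_add_meanCurvature_mul_inner p
  linarith

end maximum_principle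

/-! ### The inverse function theorem on manifolds -/

section inverse

variable {n : ℕ} {M M' : Type*} [TopologicalSpace M]
  [ChartedSpace (EuclideanSpace ℝ (Fin n)) M] [IsManifold (𝓡 n) ∞ M] [TopologicalSpace M']
  [ChartedSpace (EuclideanSpace ℝ (Fin n)) M'] {f : M → M'}

/-- The inverse function theorem for boundaryless manifolds of the same dimension. -/
theorem exists_openPartialHomeomorph_of_injective_mfderiv
    (hf : ContMDiff (𝓡 n) (𝓡 n) ∞ f) {p : M}
    (hinj : Function.Injective (mfderiv (𝓡 n) (𝓡 n) f p)) :
    ∃ e : OpenPartialHomeomorph M M', p ∈ e.source ∧ EqOn f e e.source ∧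
      ContMDiffAt (𝓡 n) (𝓡 n) ∞ e.symm (f p) := by
  set φ := chartAt (EuclideanSpace ℝ (Fin n)) p with hφ
  set ψ := chartAt (EuclideanSpace ℝ (Fin n)) (f p) with hψ
  set g := ψ ∘ f ∘ φ.symm with hg
  have hpφ : p ∈ φ.source := mem_chart_source _ p
  have hpψ : f p ∈ ψ.source := mem_chart_source _ (f p)
  have hgp : ContDiffAt ℝ ∞ g (φ p) := by
    have := (contMDiffAt_iff.1 (hf p)).2
    simp only [ModelWithCorners.range_eq_univ, contDiffWithinAt_univ] at this
    exact this
  have hgd : mfderiv (𝓡 n) (𝓡 n) f p = fderiv ℝ g (φ p) := by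
    rw [(hf.mdifferentiableAt (x := p) (by simp)).mfderiv]
    simp only [ModelWithCorners.range_eq_univ, fderivWithin_univ]
    rfl
  have hgi : Function.Injective (fderiv ℝ g (φ p)) := fun v w h =>
    hinj (by rw [hgd]; exact h)
  set e : EuclideanSpace ℝ (Fin n) ≃L[ℝ] EuclideanSpace ℝ (Fin n) :=
    (LinearEquiv.ofInjectiveEndo (fderiv ℝ g (φ p)).toLinearMap hgi).toContinuousLinearEquiv
  have hge : HasFDerivAt g (e : EuclideanSpace ℝ (Fin n) →L[ℝ] EuclideanSpace ℝ (Fin n)) (φ p) := by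
    refine (hgp.differentiableAt (by simp)).hasFDerivAt.congr_fderiv ?_
    ext1 v
    rfl
  set G := hgp.toOpenPartialHomeomorph g hge (by simp) with hG
  have hpG : φ p ∈ G.source := hgp.mem_toOpenPartialHomeomorph_source hge (by simp)
  have hsymm : ContDiffAt ℝ ∞ G.symm (g (φ p)) := hgp.to_localInverse hge (by simp)
  have hgφ : g (φ p) = ψ (f p) := by simp [hg, φ.left_inv hpφ]
  have hopen : IsOpen (f ⁻¹' ψ.source) := ψ.open_source.preimage hf.continuous
  refine ⟨((φ.trans G).trans ψ.symm).restrOpen _ hopen, ?_, ?_, ?_⟩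
  · have h : g (φ p) ∈ ψ.target := by rw [hgφ]; exact ψ.map_source hpψ
    simp only [OpenPartialHomeomorph.restrOpen_source, OpenPartialHomeomorph.trans_source,
      mem_inter_iff, mem_preimage]
    exact ⟨⟨⟨hpφ, hpG⟩, h⟩, hpψ⟩
  · intro x hx
    simp only [OpenPartialHomeomorph.restrOpen_source, OpenPartialHomeomorph.trans_source,
      mem_inter_iff, mem_preimage] at hx
    obtain ⟨⟨⟨hxφ, -⟩, -⟩, hxψ⟩ := hx
    change f x = ψ.symm (ψ (f (φ.symm (φ x))))
    rw [φ.left_inv hxφ, ψ.left_inv hxψ]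
  · change ContMDiffAt (𝓡 n) (𝓡 n) ∞ (φ.symm ∘ G.symm ∘ ψ) (f p)
    have h1 : ContMDiffAt (𝓡 n) 𝓘(ℝ, EuclideanSpace ℝ (Fin n)) ∞ ψ (f p) :=
      contMDiffAt_extChartAt
    have h2 : ContMDiffAt 𝓘(ℝ, EuclideanSpace ℝ (Fin n)) 𝓘(ℝ, EuclideanSpace ℝ (Fin n)) ∞ G.symm
        (ψ (f p)) := by
      rw [← hgφ]
      exact hsymm.contMDiffAt
    have h3 : ContMDiffAt 𝓘(ℝ, EuclideanSpace ℝ (Fin n)) (𝓡 n) ∞ φ.symm (G.symm (ψ (f p))) := by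
      have : G.symm (ψ (f p)) = φ p := by
        rw [← hgφ]
        exact G.left_inv hpG
      rw [this]
      exact (contMDiffOn_extChartAt_symm (n := ∞) p).contMDiffAt
        ((isOpen_extChartAt_target p).mem_nhds (mem_extChartAt_target p))
    exact h3.comp (f p) (h2.comp (f p) h1)

theorem isLocalHomeomorph_of_injective_mfderiv (hf : ContMDiff (𝓡 n) (𝓡 n) ∞ f)
    (hinj : ∀ p, Function.Injective (mfderiv (𝓡 n) (𝓡 n) f p)) : IsLocalHomeomorph f :=
  IsLocalHomeomorph.mk f fun p =>
    let ⟨e, hp, he, _⟩ := exists_openPartialHomeomorph_of_injective_mfderiv hf (hinj p)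
    ⟨e, hp, he⟩

theorem exists_diffeomorph_of_injective_mfderiv (hf : ContMDiff (𝓡 n) (𝓡 n) ∞ f)
    (hinj : ∀ p, Function.Injective (mfderiv (𝓡 n) (𝓡 n) f p)) (hbij : Function.Bijective f) :
    ∃ Φ : M ≃ₘ^∞⟮𝓡 n, 𝓡 n⟯ M', ⇑Φ = f := by
  refine ⟨⟨Equiv.ofBijective f hbij, hf, fun y => ?_⟩, rfl⟩
  obtain ⟨p, rfl⟩ := hbij.2 y
  obtain ⟨e, hp, he, hsymm⟩ := exists_openPartialHomeomorph_of_injective_mfderiv hf (hinj p)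
  have hfp : f p ∈ e.target := by
    rw [he hp]
    exact e.map_source hp
  refine hsymm.congr_of_eventuallyEq ?_
  filter_upwards [e.open_target.mem_nhds hfp] with z hz
  refine (Equiv.symm_apply_eq _).2 ?_
  change z = f (e.symm z)
  rw [he (e.map_target hz), e.right_inv hz]

end inverse

/-! ### Maps to the unit sphere and the induced metric -/

section sphere

variable {n : ℕ} {M : Type*} [TopologicalSpace M] [ChartedSpace (EuclideanSpace ℝ (Fin n)) M]
  {X : M → EuclideanSpace ℝ (Fin (n + 1))}

theorem mvfderiv_smul_coe_comp {Φ : M → Metric.sphere (0 : EuclideanSpace ℝ (Fin (n + 1))) 1}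
    (hΦ : ContMDiff (𝓡 n) (𝓡 n) ∞ Φ) (r : ℝ) (p : M) (v : TangentSpace (𝓡 n) p) :
    mvfderiv (𝓡 n) (fun y : Metric.sphere (0 : EuclideanSpace ℝ (Fin (n + 1))) 1 =>
        r • (y : EuclideanSpace ℝ (Fin (n + 1)))) (Φ p) (mfderiv (𝓡 n) (𝓡 n) Φ p v) =
      mvfderiv (𝓡 n) (fun p => r • (Φ p : EuclideanSpace ℝ (Fin (n + 1)))) p v := by
  have : Fact (Module.finrank ℝ (EuclideanSpace ℝ (Fin (n + 1))) = n + 1) := ⟨by simp⟩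
  have h1 : ContMDiff (𝓡 n) 𝓘(ℝ, EuclideanSpace ℝ (Fin (n + 1))) ∞
      (fun y : Metric.sphere (0 : EuclideanSpace ℝ (Fin (n + 1))) 1 =>
        r • (y : EuclideanSpace ℝ (Fin (n + 1)))) :=
    (contDiff_const_smul r).contMDiff.comp contMDiff_coe_sphere
  exact (mfderiv_comp_apply p (h1.mdifferentiableAt (by simp)) (hΦ.mdifferentiableAt (by simp))
    v).symm

theorem injective_mfderiv_of_firstFundamentalForm_eq {r : ℝ}
    {Φ : M → Metric.sphere (0 : EuclideanSpace ℝ (Fin (n + 1))) 1}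
    (hΦ : ContMDiff (𝓡 n) (𝓡 n) ∞ Φ) {p : M} (hX : Function.Injective (mvfderiv (𝓡 n) X p))
    (h : ∀ v w, firstFundamentalForm (n := n) (fun p => r • (Φ p : EuclideanSpace ℝ (Fin (n + 1)))) p v w =
      firstFundamentalForm X p v w) :
    Function.Injective (mfderiv (𝓡 n) (𝓡 n) Φ p) := by
  refine (injective_iff_map_eq_zero _).2 fun v hv => ?_
  have h1 := h v v
  simp only [firstFundamentalForm, ← mvfderiv_smul_coe_comp hΦ, hv, map_zero,
    inner_zero_left] at h1
  exact (injective_iff_map_eq_zero _).1 hX v (inner_self_eq_zero.1 h1.symm)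

theorem isIsometricToSphere_of_bijective [IsManifold (𝓡 n) ∞ M]
    (hX : ∀ p, Function.Injective (mvfderiv (𝓡 n) X p)) {r : ℝ}
    {Φ : M → Metric.sphere (0 : EuclideanSpace ℝ (Fin (n + 1))) 1}
    (hΦ : ContMDiff (𝓡 n) (𝓡 n) ∞ Φ) (hbij : Function.Bijective Φ)
    (h : ∀ p v w, firstFundamentalForm (n := n) (fun p => r • (Φ p : EuclideanSpace ℝ (Fin (n + 1)))) p v w =
      firstFundamentalForm X p v w) : IsIsometricToSphere X r := by
  obtain ⟨Ψ, rfl⟩ := exists_diffeomorph_of_injective_mfderiv hΦ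
    (fun p => injective_mfderiv_of_firstFundamentalForm_eq hΦ (hX p) (h p)) hbij
  refine ⟨Ψ, fun p v w => ?_⟩
  rw [← h]
  simp only [firstFundamentalForm, mvfderiv_smul_coe_comp hΦ]

theorem exists_contMDiff_sphere_of_norm_eq [IsManifold (𝓡 n) ∞ M]
    (hX : ContMDiff (𝓡 n) 𝓘(ℝ, EuclideanSpace ℝ (Fin (n + 1))) ∞ X) {ρ : ℝ} (hρ : 0 < ρ)
    (h : ∀ p, ‖X p‖ = ρ) :
    ∃ Y : M → Metric.sphere (0 : EuclideanSpace ℝ (Fin (n + 1))) 1,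
      ContMDiff (𝓡 n) (𝓡 n) ∞ Y ∧ (fun p => ρ • (Y p : EuclideanSpace ℝ (Fin (n + 1)))) = X := by
  have : Fact (Module.finrank ℝ (EuclideanSpace ℝ (Fin (n + 1))) = n + 1) := ⟨by simp⟩
  have h1 : ContMDiff (𝓡 n) 𝓘(ℝ, EuclideanSpace ℝ (Fin (n + 1))) ∞ fun p => ρ⁻¹ • X p :=
    (contDiff_const_smul ρ⁻¹).contMDiff.comp hX
  refine ⟨_, h1.codRestrict_sphere fun p => ?_, ?_⟩
  · rw [mem_sphere_zero_iff_norm, norm_smul, h, norm_inv, Real.norm_of_nonneg hρ.le,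
      inv_mul_cancel₀ hρ.ne']
  · funext p
    simp [smul_smul, mul_inv_cancel₀ hρ.ne']

end sphere

/-! ### Local homeomorphisms onto spheres of dimension at least two -/

section covering

variable {n : ℕ} {M : Type*} [TopologicalSpace M] [ChartedSpace (EuclideanSpace ℝ (Fin n)) M]

theorem isConnected_ball_diff_center (hn : 2 ≤ n) (c : EuclideanSpace ℝ (Fin n)) {r : ℝ}
    (hr : 0 < r) : IsConnected (Metric.ball c r \ {c}) := by
  have h1 : 1 < Module.rank ℝ (EuclideanSpace ℝ (Fin n)) := by
    rw [← Module.finrank_eq_rank, finrank_euclideanSpace_fin]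
    exact_mod_cast hn
  have h2 := (isConnected_compl_singleton_of_one_lt_rank h1 (0 : EuclideanSpace ℝ (Fin n))).image
    (OpenPartialHomeomorph.univBall c r) (OpenPartialHomeomorph.continuous_univBall c r).continuousOn
  convert h2 using 1
  ext z
  constructor
  · rintro ⟨hz, hzc⟩
    rw [← OpenPartialHomeomorph.univBall_target c hr] at hz
    refine ⟨(OpenPartialHomeomorph.univBall c r).symm z, fun h0 => hzc ?_,
      (OpenPartialHomeomorph.univBall c r).right_inv hz⟩
    have := (OpenPartialHomeomorph.univBall c r).right_inv hz
    rw [mem_singleton_iff.1 h0, OpenPartialHomeomorph.univBall_apply_zero] at this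
    exact this.symm
  · rintro ⟨w, hw, rfl⟩
    have hs : ∀ u, u ∈ (OpenPartialHomeomorph.univBall c r).source := by simp
    refine ⟨?_, fun h => hw ?_⟩
    · rw [← OpenPartialHomeomorph.univBall_target c hr]
      exact (OpenPartialHomeomorph.univBall c r).map_source (hs w)
    · refine (OpenPartialHomeomorph.univBall c r).injOn (hs w) (hs 0) ?_
      rw [OpenPartialHomeomorph.univBall_apply_zero]
      exact h

theorem exists_isConnected_mem_nhdsNE (hn : 2 ≤ n) {x : M} {s : Set M} (hs : s ∈ 𝓝[≠] x) :
    ∃ O ∈ 𝓝[≠] x, O ⊆ s ∧ IsConnected O := by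
  set φ := chartAt (EuclideanSpace ℝ (Fin n)) x with hφ
  have hx : x ∈ φ.source := mem_chart_source _ x
  have hx' : φ x ∈ φ.target := φ.map_source hx
  have hsx : insert x s ∈ 𝓝 x := insert_mem_nhds_iff.2 hs
  have h1 : φ.target ∩ φ.symm ⁻¹' (insert x s) ∈ 𝓝 (φ x) :=
    inter_mem (φ.open_target.mem_nhds hx')
      ((φ.continuousAt_symm hx').preimage_mem_nhds (by rwa [φ.left_inv hx]))
  obtain ⟨r, hr, hball⟩ := Metric.mem_nhds_iff.1 h1
  have hmem : φ.symm '' Metric.ball (φ x) r ∈ 𝓝 x := by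
    have := φ.symm.image_mem_nhds hx' (Metric.ball_mem_nhds _ hr)
    rwa [φ.left_inv hx] at this
  refine ⟨φ.symm '' (Metric.ball (φ x) r \ {φ x}), ?_, ?_, ?_⟩
  · rw [mem_nhdsWithin_iff_eventually]
    filter_upwards [hmem]
    rintro _ ⟨z, hz, rfl⟩ hne
    exact ⟨z, ⟨hz, fun h => hne (by rw [mem_singleton_iff.1 h, φ.left_inv hx]; rfl)⟩, rfl⟩
  · rintro _ ⟨z, ⟨hz, hzne⟩, rfl⟩
    refine (hball hz).2.resolve_left fun h => hzne ?_
    rw [mem_singleton_iff, ← h, φ.right_inv (hball hz).1]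
  · exact (isConnected_ball_diff_center hn _ hr).image _
      (φ.continuousOn_symm.mono fun z hz => (hball hz.1).1)

/-- The sphere minus `v` is the image of a vector space, so inverse stereographic projection lifts
to an open sheet `range σ` on which `f` is injective. Removing the discrete fibre over `v` does not
disconnect `M` locally when `n ≥ 2`, so one sheet fills everything away from that fibre. -/
theorem injective_of_isLocalHomeomorph_sphere [CompactSpace M] [T2Space M]
    [ConnectedSpace M] (hn : 2 ≤ n)
    {f : M → Metric.sphere (0 : EuclideanSpace ℝ (Fin (n + 1))) 1} (hf : IsLocalHomeomorph f) :
    Function.Injective f := by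
  intro x x' hxx'
  have hcov : IsCoveringMap f := isLocalHomeomorph_iff_isCoveringMap.1 hf
  set v := -f x with hv
  have hvn : ‖(v : EuclideanSpace ℝ (Fin (n + 1)))‖ = 1 := norm_eq_of_mem_sphere v
  have hxv : f x ≠ v := ne_neg_of_mem_unit_sphere ℝ (f x)
  set e := stereographic hvn with he
  have hemb := isOpenEmbedding_stereographic_symm hvn
  have hrange : range e.symm = {v}ᶜ := range_stereographic_symm hvn v.2
  have hlift : ∀ y, f y ≠ v → ∃ σ : C((ℝ ∙ (v : EuclideanSpace ℝ (Fin (n + 1))))ᗮ, M),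
      ∃ a, σ a = y ∧ f ∘ σ = e.symm ∧ IsOpenEmbedding σ := by
    intro y hy
    obtain ⟨a, ha⟩ : f y ∈ range e.symm := by rw [hrange]; exact hy
    obtain ⟨σ, ⟨hσa, hσ⟩, -⟩ := hcov.existsUnique_continuousMap_lifts
      ⟨e.symm, hemb.continuous⟩ a y ha.symm
    have hσ' : f ∘ σ = e.symm := hσ
    exact ⟨σ, a, hσa, hσ', hf.isOpenEmbedding_of_comp (by rw [hσ']; exact hemb) σ.continuous⟩
  obtain ⟨σ, a, hσa, hσ, hσo⟩ := hlift x hxv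
  have hUopen : IsOpen (range σ) := hσo.isOpen_range
  -- Off the fibre over `v`, two sheets are either equal or disjoint, so the complement of a sheet
  -- is open there.
  have hW : ∀ y, f y ≠ v → y ∉ range σ → (range σ)ᶜ ∈ 𝓝 y := by
    intro y hy hyσ
    obtain ⟨σ', a', hσa', hσ', hσo'⟩ := hlift y hy
    refine mem_of_superset (hσo'.isOpen_range.mem_nhds ⟨a', hσa'⟩) ?_
    rintro _ ⟨b, rfl⟩ ⟨c, hc⟩
    have hbc : c = b := by
      refine hemb.injective ?_
      exact (congrFun hσ c).symm.trans ((congrArg f hc).trans (congrFun hσ' b))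
    have := hcov.eq_of_comp_eq σ.continuous σ'.continuous (hσ.trans hσ'.symm) b (hbc ▸ hc)
    exact hyσ ⟨a', by rw [this, hσa']⟩
  have hne : ∀ y, ∀ᶠ z in 𝓝[≠] y, f z ≠ v := by
    intro y
    by_cases hy : f y = v
    · obtain ⟨O, hO, hyO, hinj⟩ := hf.isLocallyInjective y
      filter_upwards [mem_nhdsWithin_of_mem_nhds (hO.mem_nhds hyO), self_mem_nhdsWithin]
        with z hz hzy hzv
      exact hzy (hinj hz hyO (hzv.trans hy.symm))
    · exact eventually_nhdsWithin_of_eventually_nhds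
        (hf.continuous.continuousAt.eventually_ne hy)
  have hbot : ∀ y : M, (𝓝[≠] y).NeBot := by
    intro y
    refine ⟨fun h => ?_⟩
    obtain ⟨O, -, hO, hO'⟩ := exists_isConnected_mem_nhdsNE hn (x := y) (s := ∅) (by simp [h])
    exact hO'.nonempty.not_subset_empty hO
  -- A connected punctured neighbourhood avoiding the fibre over `v` lies wholly in the sheet or
  -- wholly outside it.
  have hdich : ∀ y, (∀ᶠ z in 𝓝[≠] y, z ∈ range σ) ∨ ∀ᶠ z in 𝓝[≠] y, z ∉ range σ := by
    intro y
    obtain ⟨O, hO, hOs, hOc⟩ := exists_isConnected_mem_nhdsNE hn (hne y)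
    by_cases h : (O ∩ range σ).Nonempty
    · left
      refine mem_of_superset hO ?_
      refine hOc.isPreconnected.subset_of_closure_inter_subset hUopen h ?_
      rintro z ⟨hz, hzO⟩
      by_contra hzσ
      exact (mem_closure_iff_nhds.1 hz _ (hW z (hOs hzO) hzσ)).elim fun w hw => hw.1 hw.2
    · right
      filter_upwards [hO] with z hz hzσ using h ⟨z, hz, hzσ⟩
  have hclopen : IsClopen {y | ∀ᶠ z in 𝓝[≠] y, z ∈ range σ} := by
    constructor
    · refine isOpen_compl_iff.1 (isOpen_iff_mem_nhds.2 fun y hy => ?_)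
      have h := (hdich y).resolve_left hy
      have h1 : ∀ᶠ z in 𝓝[≠] y, ∀ᶠ w in 𝓝[≠] z, w ∉ range σ := by
        have := eventually_eventually_nhdsWithin.2 h
        filter_upwards [this, self_mem_nhdsWithin] with z hz hzy
        rw [(isOpen_compl_singleton (x := y)).nhdsWithin_eq hzy] at hz
        exact eventually_nhdsWithin_of_eventually_nhds hz
      have h2 : ∀ᶠ z in 𝓝 y, ∀ᶠ w in 𝓝[≠] z, w ∉ range σ := by
        rw [eventually_nhdsWithin_iff] at h1
        filter_upwards [h1] with z hz
        by_cases hzy : z = y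
        · rwa [hzy]
        · exact hz hzy
      filter_upwards [h2] with z hz hz'
      exact ((hz.and hz').exists).elim fun w hw => hw.1 hw.2
    · refine isOpen_iff_mem_nhds.2 fun y hy => ?_
      have hy' : ∀ᶠ z in 𝓝[≠] y, z ∈ range σ := hy
      rw [eventually_nhdsWithin_iff] at hy'
      filter_upwards [hy'] with z hz
      by_cases hzy : z = y
      · rwa [hzy]
      · exact eventually_nhdsWithin_of_eventually_nhds (hUopen.mem_nhds (hz hzy))
  have huniv := hclopen.eq_univ ⟨x, eventually_nhdsWithin_of_eventually_nhds
    (hUopen.mem_nhds ⟨a, hσa⟩)⟩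
  have hx' : x' ∈ range σ := by
    by_contra h
    have h1 : ∀ᶠ z in 𝓝[≠] x', z ∈ range σ := by
      have : x' ∈ {y | ∀ᶠ z in 𝓝[≠] y, z ∈ range σ} := huniv ▸ mem_univ x'
      exact this
    have h2 := eventually_nhdsWithin_of_eventually_nhds (s := {x'}ᶜ)
      (hW x' (hxx' ▸ hxv) h)
    exact ((h1.and h2).exists).elim fun w hw => hw.2 hw.1
  obtain ⟨b, rfl⟩ := hx'
  rw [← hσa] at hxx' ⊢
  refine congrArg σ (hemb.injective ?_)
  rw [← hσ]
  exact hxx'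

end covering

/-! ### Coverings of the circle, for the case of dimension one -/

section circle

/-- The arc length parametrization of the unit circle. -/
noncomputable def circleCurve (t : ℝ) : EuclideanSpace ℝ (Fin (1 + 1)) := !₂[Real.cos t, Real.sin t]

@[simp] theorem circleCurve_zero (t : ℝ) : circleCurve t 0 = Real.cos t := rfl

@[simp] theorem circleCurve_one (t : ℝ) : circleCurve t 1 = Real.sin t := rfl

theorem norm_sq_eq_add_sq (y : EuclideanSpace ℝ (Fin (1 + 1))) : ‖y‖ ^ 2 = y 0 ^ 2 + y 1 ^ 2 := by
  rw [EuclideanSpace.real_norm_sq_eq, Fin.sum_univ_two]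

theorem norm_circleCurve (t : ℝ) : ‖circleCurve t‖ = 1 := by
  have h := norm_sq_eq_add_sq (circleCurve t)
  rw [circleCurve_zero, circleCurve_one, Real.cos_sq_add_sin_sq] at h
  exact (pow_eq_one_iff_of_nonneg (norm_nonneg _) two_ne_zero).1 h

theorem contDiff_circleCurve : ContDiff ℝ ∞ circleCurve := by
  refine contDiff_euclidean.2 fun i => ?_
  fin_cases i
  · exact Real.contDiff_cos
  · exact Real.contDiff_sin

theorem hasDerivAt_circleCurve (t : ℝ) :
    HasDerivAt circleCurve (circleCurve (t + Real.pi / 2)) t := by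
  refine HasStrictDerivAt.hasDerivAt (hasStrictFDerivAt_euclidean.2 fun i => ?_)
  fin_cases i
  · refine (Real.hasStrictDerivAt_cos t).hasStrictFDerivAt.congr_fderiv ?_
    ext
    simp [Real.cos_add_pi_div_two]
  · refine (Real.hasStrictDerivAt_sin t).hasStrictFDerivAt.congr_fderiv ?_
    ext
    simp [Real.sin_add_pi_div_two]

theorem circleCurve_eq_iff {s t : ℝ} :
    circleCurve s = circleCurve t ↔ ∃ m : ℤ, s - t = 2 * Real.pi * m := by
  rw [← Real.Angle.angle_eq_iff_two_pi_dvd_sub]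
  constructor
  · intro h
    exact Real.Angle.cos_sin_inj (congrArg (fun y => y 0) h) (congrArg (fun y => y 1) h)
  · intro h
    have h1 := congrArg Real.Angle.cos h
    have h2 := congrArg Real.Angle.sin h
    simp only [Real.Angle.cos_coe, Real.Angle.sin_coe] at h1 h2
    simp [circleCurve, h1, h2]

theorem exists_circleCurve_eq {y : EuclideanSpace ℝ (Fin (1 + 1))} (hy : ‖y‖ = 1) :
    ∃ t, circleCurve t = y := by
  have h := norm_sq_eq_add_sq y
  set z : ℂ := ⟨y 0, y 1⟩ with hz
  have hz1 : ‖z‖ = 1 := by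
    have h2 : ‖z‖ ^ 2 = 1 := by
      rw [Complex.sq_norm, Complex.normSq_apply, ← sq, ← sq, ← h, hy, one_pow]
    exact (pow_eq_one_iff_of_nonneg (norm_nonneg _) two_ne_zero).1 h2
  refine ⟨z.arg, PiLp.ext fun i => ?_⟩
  fin_cases i
  · change Real.cos z.arg = y 0
    rw [Complex.cos_arg (norm_ne_zero_iff.1 (by rw [hz1]; exact one_ne_zero)), hz1, div_one]
  · change Real.sin z.arg = y 1
    rw [Complex.sin_arg, hz1, div_one]

/-- A branch of the angle function near the point of angle `t₀`. -/
noncomputable def localAngle (t₀ : ℝ) (y : EuclideanSpace ℝ (Fin (1 + 1))) : ℝ :=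
  t₀ + Real.arcsin (Real.cos t₀ * y 1 - Real.sin t₀ * y 0)

theorem localAngle_circleCurve (t₀ : ℝ) : localAngle t₀ (circleCurve t₀) = t₀ := by
  simp [localAngle, mul_comm]

theorem contDiffAt_localAngle (t₀ : ℝ) : ContDiffAt ℝ ∞ (localAngle t₀) (circleCurve t₀) := by
  have h0 : Real.cos t₀ * circleCurve t₀ 1 - Real.sin t₀ * circleCurve t₀ 0 = 0 := by
    simp [mul_comm]
  refine contDiffAt_const.add (ContDiffAt.comp (g := Real.arcsin) _
    (Real.contDiffAt_arcsin ?_ ?_) ?_)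
  · rw [h0]; norm_num
  · rw [h0]; norm_num
  · fun_prop

theorem eventually_circleCurve_localAngle (t₀ : ℝ) :
    ∀ᶠ y in 𝓝 (circleCurve t₀), ‖y‖ = 1 → circleCurve (localAngle t₀ y) = y := by
  -- Here `c` and `s` play the roles of `cos (t - t₀)` and `sin (t - t₀)`; positivity of `c` selects
  -- the branch on which `arcsin` recovers the angle.
  have hpos : ∀ᶠ y in 𝓝 (circleCurve t₀), 0 < Real.cos t₀ * y 0 + Real.sin t₀ * y 1 := by
    have hc : Continuous fun y : EuclideanSpace ℝ (Fin (1 + 1)) =>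
      Real.cos t₀ * y 0 + Real.sin t₀ * y 1 := by fun_prop
    refine hc.continuousAt.eventually_const_lt ?_
    beta_reduce
    rw [circleCurve_zero, circleCurve_one, ← sq, ← sq, Real.cos_sq_add_sin_sq]
    exact one_pos
  filter_upwards [hpos] with y hy hn
  have h := norm_sq_eq_add_sq y
  rw [hn, one_pow] at h
  set c := Real.cos t₀ * y 0 + Real.sin t₀ * y 1 with hc
  set s := Real.cos t₀ * y 1 - Real.sin t₀ * y 0 with hs
  have hcs := Real.cos_sq_add_sin_sq t₀
  have hsum : c ^ 2 + s ^ 2 = 1 := by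
    have : c ^ 2 + s ^ 2 = (Real.cos t₀ ^ 2 + Real.sin t₀ ^ 2) * (y 0 ^ 2 + y 1 ^ 2) := by
      rw [hc, hs]; ring
    rw [this, hcs, ← h, one_mul]
  have hs1 : s ^ 2 ≤ 1 := by linarith [sq_nonneg c]
  have hsin : Real.sin (Real.arcsin s) = s :=
    Real.sin_arcsin (neg_le_of_abs_le ((sq_le_one_iff_abs_le_one s).1 hs1))
      (le_of_abs_le ((sq_le_one_iff_abs_le_one s).1 hs1))
  have hcos : Real.cos (Real.arcsin s) = c := by
    rw [Real.cos_arcsin, ← hsum, add_sub_cancel_right, Real.sqrt_sq hy.le]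
  refine PiLp.ext fun i => ?_
  fin_cases i
  · change Real.cos (t₀ + Real.arcsin s) = y 0
    rw [Real.cos_add, hcos, hsin, hc, hs]
    linear_combination y 0 * hcs
  · change Real.sin (t₀ + Real.arcsin s) = y 1
    rw [Real.sin_add, hcos, hsin, hc, hs]
    linear_combination y 1 * hcs

/-- The arc length parametrization, with values in the unit sphere of the plane. -/
noncomputable def sphereCurve (t : ℝ) : Metric.sphere (0 : EuclideanSpace ℝ (Fin (1 + 1))) 1 :=
  ⟨circleCurve t, mem_sphere_zero_iff_norm.2 (norm_circleCurve t)⟩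

theorem contMDiff_sphereCurve : ContMDiff 𝓘(ℝ, ℝ) (𝓡 1) ∞ sphereCurve := by
  have : Fact (Module.finrank ℝ (EuclideanSpace ℝ (Fin (1 + 1))) = 1 + 1) := ⟨by simp⟩
  exact contDiff_circleCurve.contMDiff.codRestrict_sphere
    fun t => mem_sphere_zero_iff_norm.2 (norm_circleCurve t)

theorem sphereCurve_eq_iff {s t : ℝ} :
    sphereCurve s = sphereCurve t ↔ ∃ m : ℤ, s - t = 2 * Real.pi * m :=
  Subtype.ext_iff.trans circleCurve_eq_iff

theorem exists_sphereCurve_eq (y : Metric.sphere (0 : EuclideanSpace ℝ (Fin (1 + 1))) 1) :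
    ∃ t, sphereCurve t = y :=
  let ⟨t, ht⟩ := exists_circleCurve_eq (norm_eq_of_mem_sphere y)
  ⟨t, Subtype.ext ht⟩

theorem eventually_sphereCurve_localAngle (t₀ : ℝ) :
    ∀ᶠ y : Metric.sphere (0 : EuclideanSpace ℝ (Fin (1 + 1))) 1 in 𝓝 (sphereCurve t₀),
      sphereCurve (localAngle t₀ y) = y := by
  have h : Tendsto (fun y : Metric.sphere (0 : EuclideanSpace ℝ (Fin (1 + 1))) 1 =>
      (y : EuclideanSpace ℝ (Fin (1 + 1)))) (𝓝 (sphereCurve t₀)) (𝓝 (circleCurve t₀)) :=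
    continuous_subtype_val.tendsto _
  filter_upwards [h.eventually (eventually_circleCurve_localAngle t₀)] with y hy
  exact Subtype.ext (hy (norm_eq_of_mem_sphere y))

/-- A lift `γ` of the arc length parametrization through a local homeomorphism `f` onto the circle
is locally inverted by the angle of `f`. -/
theorem eventually_lift_localAngle {M : Type*} [TopologicalSpace M]
    {f : M → Metric.sphere (0 : EuclideanSpace ℝ (Fin (1 + 1))) 1} (hf : IsLocalHomeomorph f)
    {γ : ℝ → M} (hγ : Continuous γ) (hfγ : ∀ t, f (γ t) = sphereCurve t) (t₀ : ℝ) :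
    ∀ᶠ x in 𝓝 (γ t₀), γ (localAngle t₀ (f x)) = x := by
  obtain ⟨U, hU, hxU, hinj⟩ := hf.isLocallyInjective (γ t₀)
  have h1 : Tendsto (fun x => (f x : EuclideanSpace ℝ (Fin (1 + 1)))) (𝓝 (γ t₀))
      (𝓝 (circleCurve t₀)) := by
    have := (continuous_subtype_val.comp hf.continuous).tendsto (γ t₀)
    rwa [Function.comp_apply, hfγ] at this
  have h2 : Tendsto (fun x => γ (localAngle t₀ (f x))) (𝓝 (γ t₀)) (𝓝 (γ t₀)) := by
    have := (contDiffAt_localAngle t₀).continuousAt.tendsto.comp h1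
    rw [localAngle_circleCurve] at this
    exact (hγ.tendsto t₀).comp this
  have h3 : Tendsto f (𝓝 (γ t₀)) (𝓝 (sphereCurve t₀)) := hfγ t₀ ▸ hf.continuous.tendsto (γ t₀)
  filter_upwards [hU.mem_nhds hxU, h2.eventually (hU.mem_nhds hxU),
    h3.eventually (eventually_sphereCurve_localAngle t₀)] with x hx hx' hfx
  exact hinj hx' hx ((hfγ _).trans hfx)

section lift

variable {M : Type*} [TopologicalSpace M]
  {f : M → Metric.sphere (0 : EuclideanSpace ℝ (Fin (1 + 1))) 1}

/-- `s - t` is a multiple of `2π`, so translating `γ` by it gives another lift of the same curve;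
the two lifts agree at `t`, hence everywhere. -/
theorem periodic_of_lift_eq (hf : IsCoveringMap f) {γ : ℝ → M} (hγ : Continuous γ)
    (hfγ : ∀ t, f (γ t) = sphereCurve t) {s t : ℝ} (hst : γ s = γ t) :
    Function.Periodic γ (s - t) := by
  obtain ⟨m, hm⟩ := sphereCurve_eq_iff.1 ((hfγ s).symm.trans ((congrArg f hst).trans (hfγ t)))
  have h := hf.eq_of_comp_eq (g₁ := fun u => γ (u + (s - t))) (g₂ := γ) (by fun_prop) hγ
    (by
      funext u
      simp only [Function.comp_apply, hfγ]
      exact sphereCurve_eq_iff.2 ⟨m, by rw [← hm]; ring⟩) t (by simpa using hst)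
  exact fun u => congrFun h u

/-- Ranges of lifts are open, and two lifts that meet are translates of each other. The range of any
lift is therefore clopen. -/
theorem exists_surjective_lift [CompactSpace M] [T2Space M] [ConnectedSpace M]
    (hf : IsLocalHomeomorph f) :
    ∃ γ : ℝ → M, Continuous γ ∧ (∀ t, f (γ t) = sphereCurve t) ∧ Function.Surjective γ := by
  have hcov : IsCoveringMap f := isLocalHomeomorph_iff_isCoveringMap.1 hf
  have hlift : ∀ x, ∃ γ : ℝ → M, ∃ t, γ t = x ∧ Continuous γ ∧ ∀ t, f (γ t) = sphereCurve t := by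
    intro x
    obtain ⟨t, ht⟩ := exists_sphereCurve_eq (f x)
    obtain ⟨γ, ⟨hγt, hγ⟩, -⟩ := hcov.existsUnique_continuousMap_lifts
      ⟨sphereCurve, contMDiff_sphereCurve.continuous⟩ t x ht.symm
    exact ⟨γ, t, hγt, γ.continuous, fun t => congrFun hγ t⟩
  have hnhds : ∀ γ : ℝ → M, Continuous γ → (∀ t, f (γ t) = sphereCurve t) → ∀ t,
      range γ ∈ 𝓝 (γ t) := by
    intro γ hγ hfγ t
    filter_upwards [eventually_lift_localAngle hf hγ hfγ t] with x hx using ⟨_, hx⟩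
  obtain ⟨x₀⟩ := (inferInstance : Nonempty M)
  obtain ⟨γ, t₀, -, hγ, hfγ⟩ := hlift x₀
  have hclopen : IsClopen (range γ) := by
    refine ⟨isOpen_compl_iff.1 (isOpen_iff_mem_nhds.2 ?_), isOpen_iff_mem_nhds.2 ?_⟩
    · intro x hx
      obtain ⟨γ', t, rfl, hγ', hfγ'⟩ := hlift x
      refine mem_of_superset (hnhds γ' hγ' hfγ' t) ?_
      rintro _ ⟨a, rfl⟩ ⟨b, hb⟩
      obtain ⟨m, hm⟩ := sphereCurve_eq_iff.1
        ((hfγ b).symm.trans ((congrArg f hb).trans (hfγ' a)))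
      have h := hcov.eq_of_comp_eq (g₁ := fun u => γ (u + (b - a))) (g₂ := γ') (by fun_prop) hγ'
        (by
          funext u
          simp only [Function.comp_apply, hfγ, hfγ']
          exact sphereCurve_eq_iff.2 ⟨m, by rw [← hm]; ring⟩) a (by simpa using hb)
      exact hx ⟨_, congrFun h t⟩
    · rintro _ ⟨t, rfl⟩
      exact hnhds γ hγ hfγ t
  refine ⟨γ, hγ, hfγ, range_eq_univ.1 (hclopen.eq_univ ⟨_, t₀, rfl⟩)⟩

/-- `k` is the winding number: `2πk` is the least period of `γ` among the multiples of `2π`. A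
period exists by pigeonhole on the finite fibre over angle `0`. -/
theorem exists_lift_eq_iff [CompactSpace M] [T2Space M] (hf : IsLocalHomeomorph f)
    {γ : ℝ → M} (hγ : Continuous γ) (hfγ : ∀ t, f (γ t) = sphereCurve t) :
    ∃ k : ℕ, 0 < k ∧ ∀ s t, γ s = γ t ↔ sphereCurve (1 / k * s) = sphereCurve (1 / k * t) := by
  classical
  have hcov : IsCoveringMap f := isLocalHomeomorph_iff_isCoveringMap.1 hf
  have hfib : (f ⁻¹' {sphereCurve 0}).Finite := by
    have : DiscreteTopology (f ⁻¹' {sphereCurve 0}) := (hcov _).discreteTopology_fiber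
    exact ((isClosed_singleton.preimage hf.continuous).isCompact).finite ⟨this⟩
  have hex : ∃ k : ℕ, 0 < k ∧ Function.Periodic γ (2 * Real.pi * k) := by
    have := hfib.to_subtype
    obtain ⟨i, j, hij, h⟩ := Finite.exists_ne_map_eq_of_infinite
      (fun i : ℕ => (⟨γ (2 * Real.pi * i), by
        rw [mem_preimage, hfγ]
        exact sphereCurve_eq_iff.2 ⟨i, by push_cast; ring⟩⟩ : f ⁻¹' {sphereCurve 0}))
    have h' : γ (2 * Real.pi * i) = γ (2 * Real.pi * j) := congrArg Subtype.val h
    rcases hij.lt_or_gt with hlt | hlt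
    · refine ⟨j - i, Nat.sub_pos_of_lt hlt, ?_⟩
      have := periodic_of_lift_eq hcov hγ hfγ h'.symm
      rw [Nat.cast_sub hlt.le, mul_sub]
      exact this
    · refine ⟨i - j, Nat.sub_pos_of_lt hlt, ?_⟩
      have := periodic_of_lift_eq hcov hγ hfγ h'
      rw [Nat.cast_sub hlt.le, mul_sub]
      exact this
  obtain ⟨hk, hper⟩ := Nat.find_spec hex
  set k := Nat.find hex with hkdef
  have hk' : (k : ℝ) ≠ 0 := by positivity
  refine ⟨k, hk, fun s t => ⟨fun h => ?_, fun h => ?_⟩⟩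
  · obtain ⟨m, hm⟩ := sphereCurve_eq_iff.1 ((hfγ s).symm.trans ((congrArg f h).trans (hfγ t)))
    have hpm : Function.Periodic γ (2 * Real.pi * m) := hm ▸ periodic_of_lift_eq hcov hγ hfγ h
    have hkz : (k : ℤ) ≠ 0 := by exact_mod_cast hk.ne'
    -- Reducing `m` modulo `k` gives a smaller period, which must be zero by minimality of `k`.
    have hr : Function.Periodic γ (2 * Real.pi * ((m % k).toNat : ℕ)) := by
      have h1 := hpm.sub_period (hper.int_mul (m / k))
      have h2 : ((m % k).toNat : ℝ) = ((m % k : ℤ) : ℝ) := by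
        exact_mod_cast Int.toNat_of_nonneg (Int.emod_nonneg m hkz)
      have h3 : ((m % k : ℤ) : ℝ) = m - k * ((m / k : ℤ) : ℝ) := by
        exact_mod_cast Int.emod_def m k
      rw [h2, h3]
      have h4 : 2 * Real.pi * ((m : ℝ) - k * ((m / k : ℤ) : ℝ)) =
          2 * Real.pi * m - ((m / k : ℤ) : ℝ) * (2 * Real.pi * k) := by ring
      rw [h4]
      exact h1
    have hlt : (m % k).toNat < k := by
      have := Int.emod_lt_of_pos m (Int.natCast_pos.2 hk)
      omega
    have hz : ¬ 0 < (m % k).toNat := fun h0 => Nat.find_min hex hlt ⟨h0, hr⟩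
    have hdvd : (k : ℤ) ∣ m := by
      refine Int.dvd_of_emod_eq_zero ?_
      have := Int.emod_nonneg m hkz
      omega
    obtain ⟨q, rfl⟩ := hdvd
    refine sphereCurve_eq_iff.2 ⟨q, ?_⟩
    rw [← mul_sub, hm]
    push_cast
    field_simp
  · obtain ⟨m, hm⟩ := sphereCurve_eq_iff.1 h
    have hst : s = t + m * (2 * Real.pi * k) := by
      rw [← mul_sub] at hm
      field_simp at hm
      linarith
    rw [hst]
    exact hper.int_mul m t

end lift

theorem mvfderiv_congr {n m : ℕ} {M : Type*} [TopologicalSpace M]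
    [ChartedSpace (EuclideanSpace ℝ (Fin n)) M] {f g : M → EuclideanSpace ℝ (Fin m)} {p : M}
    (h : f =ᶠ[𝓝 p] g) (v : TangentSpace (𝓡 n) p) :
    mvfderiv (𝓡 n) f p v = mvfderiv (𝓡 n) g p v :=
  DFunLike.congr_fun h.mfderiv_eq v

theorem firstFundamentalForm_smul_circleCurve {M : Type*} [TopologicalSpace M]
    [ChartedSpace (EuclideanSpace ℝ (Fin 1)) M] {τ : M → ℝ} {p : M}
    (hτ : MDifferentiableAt (𝓡 1) 𝓘(ℝ, ℝ) τ p) (a b : ℝ) (v w : TangentSpace (𝓡 1) p) :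
    firstFundamentalForm (n := 1) (fun p => a • circleCurve (b * τ p)) p v w =
      (a * b) ^ 2 * (mvfderiv (𝓡 1) τ p v * mvfderiv (𝓡 1) τ p w) := by
  have h1 : HasDerivAt (fun s => a • circleCurve (b * s))
      ((a * b) • circleCurve (b * τ p + Real.pi / 2)) (τ p) := by
    have := ((hasDerivAt_circleCurve (b * τ p)).scomp (τ p)
      ((hasDerivAt_id (τ p)).const_mul b)).const_smul a
    refine this.congr_deriv ?_
    rw [mul_one, smul_smul]
  have h2 : ∀ u : TangentSpace (𝓡 1) p,
      mvfderiv (𝓡 1) (fun p => a • circleCurve (b * τ p)) p u =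
        mvfderiv (𝓡 1) τ p u • ((a * b) • circleCurve (b * τ p + Real.pi / 2)) := by
    intro u
    have h3 := mfderiv_comp_apply (I := 𝓡 1) (I' := 𝓘(ℝ, ℝ))
      (I'' := 𝓘(ℝ, EuclideanSpace ℝ (Fin (1 + 1)))) (f := τ)
      (g := fun s => a • circleCurve (b * s)) p
      h1.differentiableAt.mdifferentiableAt hτ u
    refine h3.trans ?_
    rw [mfderiv_eq_fderiv, h1.hasFDerivAt.fderiv]
    rfl
  rw [firstFundamentalForm, h2, h2, inner_smul_left, inner_smul_right, real_inner_self_eq_norm_sq,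
    norm_smul, norm_circleCurve, mul_one, Real.norm_eq_abs, sq_abs]
  simp only [conj_trivial]
  ring

/-- Dividing the angle along the lift by `k` unwinds the covering into a bijection `Φ`. The choice
of preimages `σ` is arbitrary, but `Φ` does not depend on it, and smoothness is read off from local
angles. -/
theorem exists_isIsometricToSphere_of_circle {M : Type*} [TopologicalSpace M]
    [ChartedSpace (EuclideanSpace ℝ (Fin 1)) M] [IsManifold (𝓡 1) ∞ M] [CompactSpace M]
    [T2Space M] [ConnectedSpace M] {X : M → EuclideanSpace ℝ (Fin (1 + 1))}
    (hX : ∀ p, Function.Injective (mvfderiv (𝓡 1) X p))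
    {f : M → Metric.sphere (0 : EuclideanSpace ℝ (Fin (1 + 1))) 1}
    (hf : ContMDiff (𝓡 1) (𝓡 1) ∞ f) (hfl : IsLocalHomeomorph f) {ρ : ℝ} (hρ : 0 < ρ)
    (hfX : (fun p => ρ • (f p : EuclideanSpace ℝ (Fin (1 + 1)))) = X) :
    ∃ r : ℝ, 0 < r ∧ IsIsometricToSphere X r := by
  obtain ⟨γ, hγ, hfγ, hsurj⟩ := exists_surjective_lift hfl
  obtain ⟨k, hk, hkγ⟩ := exists_lift_eq_iff hfl hγ hfγ
  have hk' : (k : ℝ) ≠ 0 := by positivity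
  choose σ hσ using hsurj
  set Φ : M → Metric.sphere (0 : EuclideanSpace ℝ (Fin (1 + 1))) 1 :=
    fun p => sphereCurve (1 / k * σ p) with hΦ
  have hΦγ : ∀ t, Φ (γ t) = sphereCurve (1 / k * t) := fun t => (hkγ _ _).1 (hσ (γ t))
  have hbij : Function.Bijective Φ := by
    refine ⟨fun p q hpq => ?_, fun y => ?_⟩
    · rw [← hσ p, ← hσ q]
      exact (hkγ _ _).2 hpq
    · obtain ⟨t, rfl⟩ := exists_sphereCurve_eq y
      refine ⟨γ (k * t), ?_⟩
      rw [hΦγ]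
      field_simp
  have hcoe : ContMDiff (𝓡 1) 𝓘(ℝ, EuclideanSpace ℝ (Fin (1 + 1))) ∞
      fun p => (f p : EuclideanSpace ℝ (Fin (1 + 1))) := by
    have : Fact (Module.finrank ℝ (EuclideanSpace ℝ (Fin (1 + 1))) = 1 + 1) := ⟨by simp⟩
    exact contMDiff_coe_sphere.comp hf
  have hlocal : ∀ p, ∃ τ : M → ℝ, ContMDiffAt (𝓡 1) 𝓘(ℝ, ℝ) ∞ τ p ∧
      (∀ᶠ q in 𝓝 p, Φ q = sphereCurve (1 / k * τ q)) ∧ ∀ᶠ q in 𝓝 p, f q = sphereCurve (τ q) := by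
    intro p
    have h := eventually_lift_localAngle hfl hγ hfγ (σ p)
    rw [hσ] at h
    refine ⟨fun q => localAngle (σ p) (f q), ?_, ?_, ?_⟩
    · have h1 : ContMDiffAt 𝓘(ℝ, EuclideanSpace ℝ (Fin (1 + 1))) 𝓘(ℝ, ℝ) ∞
          (localAngle (σ p)) (f p : EuclideanSpace ℝ (Fin (1 + 1))) := by
        have h2 : (f p : EuclideanSpace ℝ (Fin (1 + 1))) = circleCurve (σ p) := by
          rw [← hσ p, hfγ, hσ]
          rfl
        rw [h2]
        exact (contDiffAt_localAngle (σ p)).contMDiffAt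
      exact ContMDiffAt.comp (g := localAngle (σ p)) p h1 (hcoe p)
    · filter_upwards [h] with q hq
      rw [← hΦγ, hq]
    · filter_upwards [h] with q hq
      rw [← hfγ, hq]
  have hΦs : ContMDiff (𝓡 1) (𝓡 1) ∞ Φ := by
    intro p
    obtain ⟨τ, hτ, hΦτ, -⟩ := hlocal p
    refine ContMDiffAt.congr_of_eventuallyEq ?_ hΦτ
    have h1 : ContMDiff 𝓘(ℝ, ℝ) (𝓡 1) ∞ fun s : ℝ => sphereCurve (1 / k * s) :=
      contMDiff_sphereCurve.comp (contDiff_const.mul contDiff_id).contMDiff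
    exact (h1 (τ p)).comp p hτ
  -- Slowing the angle by `k` is compensated by the radius `ρ * k`, so the speed remains `ρ`.
  refine ⟨ρ * k, by positivity, isIsometricToSphere_of_bijective hX hΦs hbij fun p v w => ?_⟩
  obtain ⟨τ, hτ, hΦτ, hfτ⟩ := hlocal p
  have hτd := hτ.mdifferentiableAt (by simp)
  have e1 : (fun q => (ρ * k) • (Φ q : EuclideanSpace ℝ (Fin (1 + 1)))) =ᶠ[𝓝 p]
      fun q => (ρ * k) • circleCurve (1 / k * τ q) := by
    filter_upwards [hΦτ] with q hq
    rw [hq]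
    rfl
  have e2 : X =ᶠ[𝓝 p] fun q => ρ • circleCurve (1 * τ q) := by
    filter_upwards [hfτ] with q hq
    rw [← hfX, one_mul]
    beta_reduce
    rw [hq]
    rfl
  have h1 := firstFundamentalForm_smul_circleCurve hτd (ρ * k) (1 / k) v w
  have h2 := firstFundamentalForm_smul_circleCurve hτd ρ 1 v w
  simp only [firstFundamentalForm, mvfderiv_congr e1, mvfderiv_congr e2] at h1 h2 ⊢
  rw [h1, h2]
  field_simp

end circle

/-! ### Conclusion -/

theorem IsLambdaHypersurface.exists_isIsometricToSphere {n : ℕ} (hn : 1 ≤ n) {M : Type*}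
    [TopologicalSpace M] [ChartedSpace (EuclideanSpace ℝ (Fin n)) M] [IsManifold (𝓡 n) ∞ M]
    [T2Space M] [CompactSpace M] [ConnectedSpace M]
    {X N : M → EuclideanSpace ℝ (Fin (n + 1))} {l ρ : ℝ} (hX : IsLambdaHypersurface X N l)
    (hρ : ∀ p, ‖X p‖ = ρ) : ∃ r : ℝ, 0 < r ∧ IsIsometricToSphere X r := by
  obtain ⟨p⟩ := (inferInstance : Nonempty M)
  -- If `ρ = 0` then `X` vanishes, and the vanishing Laplacian `n + H⟨X, N⟩` reduces to `n`,
  -- contradicting `1 ≤ n`.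
  have hρpos : 0 < ρ := by
    refine lt_of_le_of_ne (hρ p ▸ norm_nonneg _) fun h0 => ?_
    have h1 := hX.nat_add_meanCurvature_mul_inner p
    rw [hX.sq_eq_of_norm_eq hρ, norm_eq_zero.1 ((hρ p).trans h0.symm), inner_zero_left, mul_zero,
      sub_self, add_zero, Nat.cast_eq_zero] at h1
    omega
  obtain ⟨Y, hY, hYX⟩ := exists_contMDiff_sphere_of_norm_eq hX.smooth hρpos hρ
  have hform : ∀ p v w, firstFundamentalForm (n := n)
      (fun p => ρ • (Y p : EuclideanSpace ℝ (Fin (n + 1)))) p v w =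
        firstFundamentalForm X p v w := fun p v w => by rw [hYX]
  have hYl : IsLocalHomeomorph Y := isLocalHomeomorph_of_injective_mfderiv hY fun p =>
    injective_mfderiv_of_firstFundamentalForm_eq hY (hX.immersion p) (hform p)
  obtain rfl | hn2 := hn.eq_or_lt
  · exact exists_isIsometricToSphere_of_circle hX.immersion hY hYl hρpos hYX
  · refine ⟨ρ, hρpos, isIsometricToSphere_of_bijective hX.immersion hY
      ⟨injective_of_isLocalHomeomorph_sphere hn2 hYl, ?_⟩ hform⟩
    have h1 : 1 < Module.rank ℝ (EuclideanSpace ℝ (Fin (n + 1))) := by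
      rw [← Module.finrank_eq_rank, finrank_euclideanSpace_fin]
      exact_mod_cast Nat.lt_succ_of_lt hn2
    have : PreconnectedSpace (Metric.sphere (0 : EuclideanSpace ℝ (Fin (n + 1))) 1) :=
      isPreconnected_iff_preconnectedSpace.1 (isPreconnected_sphere h1 0 1)
    exact range_eq_univ.1 (IsClopen.eq_univ
      ⟨(isCompact_range hYl.continuous).isClosed, hYl.isOpenMap.isOpen_range⟩ ⟨Y p, p, rfl⟩)

end LambdaHypersurface

theorem proposition1p1 {n : ℕ} (hn : 1 ≤ n) {M : Type*} [TopologicalSpace M]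
    [ChartedSpace (EuclideanSpace ℝ (Fin n)) M] [IsManifold (𝓡 n) ∞ M]
    [T2Space M] [CompactSpace M] [ConnectedSpace M]
    (X N : M → EuclideanSpace ℝ (Fin (n + 1))) (l : ℝ)
    (hX : LambdaHypersurface.IsLambdaHypersurface X N l)
    (hH : ∀ p : M,
      (LambdaHypersurface.meanCurvature (n := n) X (N p) p - l / 2) ^ 2 ≤ n + l ^ 2 / 4) :
    (∀ p : M, (LambdaHypersurface.meanCurvature (n := n) X (N p) p - l / 2) ^ 2 = n + l ^ 2 / 4) ∧
      ∃ r : ℝ, 0 < r ∧ LambdaHypersurface.IsIsometricToSphere X r := by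
  obtain ⟨ρ, hρ⟩ := hX.exists_norm_eq hH
  exact ⟨hX.sq_eq_of_norm_eq hρ, hX.exists_isIsometricToSphere hn hρ⟩
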